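/- All matroids are finite. A *cyclic flat* of a matroid $M$ is a flat that is a (possibly empty) union of circuits; the cyclic flats, ordered by inclusion, form a lattice $\mathcal{Z}(M)$. Two matroids $M$ and $N$ *have the same configuration* if $|E(M)|=|E(N)|$ and there is a lattice isomorphism $\phi:\mathcal{Z}(M)\to\mathcal{Z}(N)$ with $|\phi(F)|=|F|$ and $r_N(\phi(F))=r_M(F)$ for all $F\in\mathcal{Z}(M)$. A pair $(X,Y)$ of subsets of $E(M)$ is *modular* if $r(X)+r(Y)=r(X\cup Y)+r(X\cap Y)$. Let $P$ and $Q$ be lattice paths from $(0,0)$ to $(m,r)$ with unit north and east steps, with $P$ never going above $Q$, and let $n=m+r$. For $1\le i\le r$, let $N_i=[l_i,u_i]$, where the $i$th north step of $Q$ is its $l_i$th step and the $i$th north step of $P$ is its $u_i$th step. The *lattice path matroid* $M=M[P,Q]$ is the transversal matroid on $[n]=\{1,\dots,n\}$ with presentation $(N_1,\dots,N_r)$. An *initial connected flat* (respectively, *final connected flat*) of $M$ is a proper flat $X$ of $M$ with $r(X)\neq|X|$ for which $M|X$ is connected and that is an interval $[a]=\{1,\dots,a\}$ (respectively, $[b,n]=\{b,\dots,n\}$).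 **Theorem.** Let $M$ be a connected lattice path matroid on $[n]$. If $M$ has an initial connected flat $A=[a]$ and a final connected flat $B=[b,n]$ for which $(A,B)$ is not a modular pair, then some matroid that is not isomorphic to $M$ has the same configuration as $M$. -/

import Mathlib

/-! ### Lattice paths and the intervals `N_i` -/

/-- The two kinds of unit steps of a lattice path: north and east. -/
inductive LatticeStep
  | north
  | east
  deriving DecidableEq

/-- A lattice path starting at `(0, 0)`, written as the word of its steps. -/
abbrev LatticePath := List LatticeStep

namespace LatticePath

/-- The height (second coordinate) that the path has reached after its first `k` steps. -/
def height (P : LatticePath) (k : ℕ) : ℕ := (P.take k).count LatticeStep.north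

/-- The `k`-th step of `P` (steps are numbered from `1`) is a north step. -/
def IsNorthStep (P : LatticePath) (k : ℕ) : Prop := 1 ≤ k ∧ P[k - 1]? = some LatticeStep.north

/-- The number `k` for which step `k` of `P` is the `i`-th north step of `P`, where `i` counts from
`0` (so `northPosition P 0` is the position of the first north step of `P`). -/
noncomputable def northPosition (P : LatticePath) (i : ℕ) : ℕ := Nat.nth P.IsNorthStep i

end LatticePath

/-- A pair of lattice paths `P` (lower) and `Q` (upper) from `(0, 0)` to `(m, r)`, with `P` never
going above `Q`. -/
structure LatticePathPair (m r : ℕ) where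
  P : LatticePath
  Q : LatticePath
  count_east_P : P.count LatticeStep.east = m
  count_north_P : P.count LatticeStep.north = r
  count_east_Q : Q.count LatticeStep.east = m
  count_north_Q : Q.count LatticeStep.north = r
  height_le : ∀ k, P.height k ≤ Q.height k

/-- The path presentation: the interval `[l_i, u_i]`, where `l_i` and `u_i` are the positions of the
`i`-th north steps of the upper path `Q` and of the lower path `P`. -/
noncomputable def LatticePathPair.interval {m r : ℕ} (D : LatticePathPair m r) (i : Fin r) :
    Set ℕ :=
  Set.Icc (D.Q.northPosition i) (D.P.northPosition i)

namespace Matroid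

/-! ### Transversal matroids and lattice path matroids -/

section Transversal

variable {α ι : Type*}

/-- `I` is a partial transversal of the set system `A`. -/
def IsPartialTransversal (A : ι → Set α) (I : Set α) : Prop :=
  ∃ f : I → ι, Function.Injective f ∧ ∀ x : I, (x : α) ∈ A (f x)

theorem isPartialTransversal_iff_injOn [Nonempty ι] {A : ι → Set α} {I : Set α} :
    IsPartialTransversal A I ↔ ∃ f : α → ι, Set.InjOn f I ∧ ∀ x ∈ I, x ∈ A (f x) := by
  classical
  constructor
  · rintro ⟨f, hf, hfA⟩
    refine ⟨fun x => if h : x ∈ I then f ⟨x, h⟩ else Classical.arbitrary ι, ?_, ?_⟩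
    · intro x hx y hy hxy
      simp only [hx, hy, dite_true] at hxy
      exact congrArg Subtype.val (hf hxy)
    · intro x hx
      simpa only [hx, dite_true] using hfA ⟨x, hx⟩
  · rintro ⟨f, hf, hfA⟩
    exact ⟨fun x => f x, fun x y hxy => Subtype.ext (hf x.2 y.2 hxy), fun x => hfA x x.2⟩

theorem isPartialTransversal_augment {A : ι → Set α} {I J : Set α} (hIfin : I.Finite)
    (hI : IsPartialTransversal A I) (hJ : IsPartialTransversal A J)
    (hIJ : I.ncard < J.ncard) :
    ∃ e ∈ J, e ∉ I ∧ IsPartialTransversal A (insert e I) := by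
  classical
  have hne : Nonempty ι := by
    obtain ⟨x, hx⟩ := Set.nonempty_of_ncard_ne_zero (Nat.ne_zero_of_lt hIJ)
    exact ⟨hJ.choose ⟨x, hx⟩⟩
  simp only [isPartialTransversal_iff_injOn] at hI hJ ⊢
  obtain ⟨g, hg, hgA⟩ := hJ
  -- Induct on the number of elements of `I` whose matches under `f` and `g` differ.
  have key : ∀ (k : ℕ) (f : α → ι), Set.InjOn f I → (∀ x ∈ I, x ∈ A (f x)) →
      {x ∈ I | f x ≠ g x}.ncard = k →
      ∃ e ∈ J, e ∉ I ∧ ∃ f : α → ι, Set.InjOn f (insert e I) ∧ ∀ x ∈ insert e I, x ∈ A (f x) := by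
    intro k
    induction k using Nat.strong_induction_on with
    | _ k ih =>
      intro f hf hfA hk
      have hlt : (f '' I).ncard < (g '' J).ncard := by
        rw [hf.ncard_image, hg.ncard_image]
        exact hIJ
      obtain ⟨c, ⟨x, hxJ, rfl⟩, hc⟩ :=
        Set.exists_mem_notMem_of_ncard_lt_ncard hlt (hIfin.image f)
      have hne : ∀ y ∈ I, f y ≠ g x := fun y hy h => hc ⟨y, hy, h⟩
      have hfA' : ∀ y ∈ insert x I, y ∈ A (Function.update f x (g x) y) := by
        intro y hy
        by_cases hyx : y = x
        · subst hyx
          simpa using hgA y hxJ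
        · rw [Function.update_of_ne hyx]
          exact hfA y (hy.resolve_left hyx)
      have hinj : Set.InjOn (Function.update f x (g x)) (insert x I) := by
        intro y hy z hz hyz
        by_cases hyx : y = x <;> by_cases hzx : z = x
        · rw [hyx, hzx]
        · rw [hyx, Function.update_self, Function.update_of_ne hzx] at hyz
          exact absurd hyz.symm (hne z (hz.resolve_left hzx))
        · rw [hzx, Function.update_self, Function.update_of_ne hyx] at hyz
          exact absurd hyz (hne y (hy.resolve_left hyx))
        · rw [Function.update_of_ne hyx, Function.update_of_ne hzx] at hyz
          exact hf (hy.resolve_left hyx) (hz.resolve_left hzx) hyz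
      by_cases hxI : x ∈ I
      · refine ih _ ?_ (Function.update f x (g x)) (hinj.mono (Set.subset_insert _ _))
          (fun y hy => hfA' y (Set.mem_insert_of_mem _ hy)) rfl
        rw [← hk]
        refine Set.ncard_lt_ncard ?_ (hIfin.subset (Set.sep_subset _ _))
        refine ⟨?_, fun h => ?_⟩
        · rintro y ⟨hy, hyne⟩
          have hyx : y ≠ x := by
            rintro rfl
            simp at hyne
          rw [Function.update_of_ne hyx] at hyne
          exact ⟨hy, hyne⟩
        · exact (h ⟨hxI, hne x hxI⟩).2 (by simp)
      · exact ⟨x, hxJ, hxI, _, hinj, hfA'⟩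
  obtain ⟨f, hf, hfA⟩ := hI
  exact key _ f hf hfA rfl

/-- The transversal matroid with presentation `A` on the finite set `E`: its independent sets are
the partial transversals of `A` that are contained in `E`. -/
noncomputable def transversalMatroid (E : Set α) (hE : E.Finite) (A : ι → Set α) : Matroid α :=
  (IndepMatroid.ofFinite hE (fun I => I ⊆ E ∧ IsPartialTransversal A I)
    ⟨Set.empty_subset E, fun x => x.2.elim, fun x => x.2.elim, fun x => x.2.elim⟩
    (fun _ _ hJ hIJ => ⟨hIJ.trans hJ.1, by
      obtain ⟨f, hf, hfA⟩ := hJ.2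
      exact ⟨fun x => f (Set.inclusion hIJ x), hf.comp (Set.inclusion_injective hIJ),
        fun x => hfA (Set.inclusion hIJ x)⟩⟩)
    (fun _ _ hI hJ hIJ => by
      obtain ⟨e, heJ, heI, he⟩ :=
        isPartialTransversal_augment (hE.subset hI.1) hI.2 hJ.2 hIJ
      exact ⟨e, heJ, heI, Set.insert_subset (hJ.1 heJ) hI.1, he⟩)
    (fun _ hI => hI.1)).matroid

end Transversal

/-- The lattice path matroid `M[P, Q]`: the transversal matroid on `[n] = {1, …, n}`, `n = m + r`,
whose presentation is the path presentation of the pair `(P, Q)`. -/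
noncomputable def latticePathMatroid {m r : ℕ} (D : LatticePathPair m r) : Matroid ℕ :=
  transversalMatroid (Set.Icc 1 (m + r)) (Set.finite_Icc 1 (m + r)) D.interval

/-! ### Connectivity, connected flats, modular pairs -/

section General

variable {α β : Type*}

/-- A matroid is connected if any two distinct elements lie in a common circuit. -/
def IsConnected (M : Matroid α) : Prop :=
  ∀ x ∈ M.E, ∀ y ∈ M.E, x ≠ y → ∃ C, M.IsCircuit C ∧ x ∈ C ∧ y ∈ C

/-- `X` is a flat that is connected (`M|X` is connected), nontrivial (`r(X) ≠ |X|`) and proper. -/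
def IsProperNontrivialConnectedFlat (M : Matroid α) (X : Set α) : Prop :=
  M.IsFlat X ∧ (M ↾ X).IsConnected ∧ M.eRk X ≠ X.encard ∧ X ≠ M.E

/-- For a matroid on `[n]`: the proper nontrivial connected flats that are initial intervals
`[a] = {1, …, a}`. -/
def IsInitialConnectedFlat (M : Matroid ℕ) (A : Set ℕ) : Prop :=
  M.IsProperNontrivialConnectedFlat A ∧ ∃ a, A = Set.Icc 1 a

/-- For a matroid on `[n]`: the proper nontrivial connected flats that are final intervals
`[b, n] = {b, …, n}`. -/
def IsFinalConnectedFlat (n : ℕ) (M : Matroid ℕ) (B : Set ℕ) : Prop :=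
  M.IsProperNontrivialConnectedFlat B ∧ ∃ b, B = Set.Icc b n

/-- The pair `(X, Y)` is modular: `r(X) + r(Y) = r(X ∪ Y) + r(X ∩ Y)`. -/
def IsModularPair (M : Matroid α) (X Y : Set α) : Prop :=
  M.eRk X + M.eRk Y = M.eRk (X ∪ Y) + M.eRk (X ∩ Y)

/-! ### Cyclic flats, configurations, isomorphism -/

/-- The set of cyclic flats, i.e. of the flats that are (possibly empty) unions of circuits; it is
ordered by inclusion. -/
def cyclicFlats (M : Matroid α) : Set (Set α) :=
  {F | M.IsFlat F ∧ ∃ S : Set (Set α), (∀ C ∈ S, M.IsCircuit C) ∧ F = ⋃₀ S}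

/-- Two matroids have the same configuration: their ground sets have the same size, and there is an
isomorphism between their lattices of cyclic flats (for lattices, an isomorphism is the same as an
order isomorphism) that preserves the size and the rank of every cyclic flat. -/
def HaveSameConfiguration (M : Matroid α) (N : Matroid β) : Prop :=
  M.E.encard = N.E.encard ∧
  ∃ φ : M.cyclicFlats ≃o N.cyclicFlats, ∀ F : M.cyclicFlats,
    (φ F : Set β).encard = (F : Set α).encard ∧ N.eRk (φ F : Set β) = M.eRk (F : Set α)

/-- Two matroids are isomorphic: some bijection of their ground sets preserves independence in both
directions. -/
def IsIsomorphic (M : Matroid α) (N : Matroid β) : Prop :=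
  ∃ e : M.E ≃ N.E, ∀ I : Set M.E,
    M.Indep ((fun x : M.E => (x : α)) '' I) ↔ N.Indep ((fun x : M.E => (e x : β)) '' I)

end General

end Matroid

/-!
The matroid `N` is obtained from `M` by shifting an element `x` to an element `y`, as in extremal set
theory: its bases are those of `M`, except that a base that contains `x` and not `y` is replaced by
`B - x + y` unless the latter is a base already. In terms of ranks, `N` agrees with `M` on sets that
contain both or neither of `x` and `y`, while `Z ∪ {x}` gets the smaller and `Z ∪ {y}` the larger of
the ranks of these two sets in `M`.

For an arbitrary finite matroid `M`, if the shift is a matroid, then its cyclic flats are those of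
`M` with `y` replaced by `x` in the ones that contain `y` and not `x`, and this replacement preserves
inclusion, size and rank (`IsShift.haveSameConfiguration`). If some cyclic flat of `M` contains `x`
and not `y`, and some other one contains `y` and not `x`, then the shift is not isomorphic to `M`,
because the sum over the elements `e` of the square of the number of cyclic flats that contain `e`
increases strictly (`IsShift.not_isIsomorphic`). Checking local submodularity of the new rank function
shows that the shift is a matroid unless some base `B` that contains `x` and `y` has elements `e` and
`f` outside it for which `e` can be exchanged for `x` and not for `y`, and `f` for `y` and not for `x`
(`exists_isShift`).

The bases of `M[P, Q]` are the lattice paths between `P` and `Q` (`latticePathMatroid_isBase_iff`). In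
the connected case, the initial cyclic flats `[a]` correspond to the east-north corners `a` of `Q`,
with `r([a])` the height of `Q` there, and the final cyclic flats `[c + 1, n]` to the north-east
corners `c` of `P`. If a lattice path could lead from `P` at `c` to `Q` at `a`, then the two flats
would be a modular pair (`isModularPair_of_height_le`); so for the given pair the height of `Q` at `a`
exceeds that of `P` at `c` by more than `a - c`, truncated at `0`. Such a pair of corners with `|a - c|`
as small as possible has no other corners in between (`exists_isSeparated_forall_corner`), and
`x = min a c` and `y = max a c + 1` then work: an exchange that is possible for `x` and not for `y`
forces the path of `B` to touch `Q` between these steps, hence to touch it at `a`, and an exchange that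
is possible for `y` and not for `x` forces it to touch `P` at `c`. No path can do both.
-/

namespace Matroid

variable {α β : Type*}

/-! ### Rank functions with values in `ℕ` -/

/-- The rank of a set as a natural number; it is only used for matroids of finite rank, where it
agrees with `Matroid.eRk`. -/
noncomputable def natRk (M : Matroid α) (X : Set α) : ℕ := (M.eRk X).toNat

theorem coe_natRk (M : Matroid α) [M.RankFinite] (X : Set α) : (M.natRk X : ℕ∞) = M.eRk X :=
  ENat.natCast_toNat (eRk_ne_top_iff.2 (M.isRkFinite_set X))

theorem natRk_empty (M : Matroid α) : M.natRk ∅ = 0 := by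
  simp [natRk]

theorem natRk_mono (M : Matroid α) [M.RankFinite] {X Y : Set α} (h : X ⊆ Y) :
    M.natRk X ≤ M.natRk Y := by
  have := M.eRk_mono h
  rw [← coe_natRk, ← coe_natRk] at this
  exact_mod_cast this

theorem natRk_le_insert (M : Matroid α) [M.RankFinite] (e : α) (X : Set α) :
    M.natRk X ≤ M.natRk (insert e X) :=
  M.natRk_mono (Set.subset_insert e X)

theorem natRk_insert_le (M : Matroid α) [M.RankFinite] (e : α) (X : Set α) :
    M.natRk (insert e X) ≤ M.natRk X + 1 := by
  have := M.eRk_insert_le_add_one e X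
  rw [← coe_natRk, ← coe_natRk] at this
  exact_mod_cast this

theorem natRk_submod (M : Matroid α) [M.RankFinite] (e f : α) (X : Set α) :
    M.natRk X + M.natRk (insert e (insert f X)) ≤
      M.natRk (insert e X) + M.natRk (insert f X) := by
  have h := M.eRk_inter_add_eRk_union_le (insert e X) (insert f X)
  have h1 : insert e X ∪ insert f X = insert e (insert f X) := by
    ext z
    simp only [Set.mem_union, Set.mem_insert_iff]
    tauto
  rw [h1] at h
  simp only [← coe_natRk] at h
  have h2 : M.natRk X ≤ M.natRk (insert e X ∩ insert f X) :=
    M.natRk_mono (Set.subset_inter (Set.subset_insert _ _) (Set.subset_insert _ _))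
  have h3 : M.natRk (insert e X ∩ insert f X) + M.natRk (insert e (insert f X)) ≤
      M.natRk (insert e X) + M.natRk (insert f X) := by exact_mod_cast h
  omega

theorem natRk_insert_eq_iff (M : Matroid α) [M.RankFinite] {e : α} (he : e ∈ M.E) (X : Set α) :
    M.natRk (insert e X) = M.natRk X ↔ e ∈ M.closure X := by
  constructor
  · intro h
    by_contra hcl
    have h1 := eRk_insert_eq_add_one ⟨he, hcl⟩
    rw [← coe_natRk, ← coe_natRk, h] at h1
    have : M.natRk X = M.natRk X + 1 := by exact_mod_cast h1
    omega
  · intro h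
    have h1 := M.eRk_insert_closure_eq e X
    rw [Set.insert_eq_of_mem h, eRk_closure_eq] at h1
    simp [natRk, h1]

theorem indep_iff_natRk_eq_ncard (M : Matroid α) [M.Finite] {I : Set α} (hI : I ⊆ M.E) :
    M.Indep I ↔ M.natRk I = I.ncard := by
  have hfin : I.Finite := M.ground_finite.subset hI
  rw [indep_iff_eRk_eq_encard_of_finite hfin, ← coe_natRk, ← hfin.cast_ncard_eq]
  exact Nat.cast_inj

/-- A set is a cyclic flat if and only if adding an element raises its rank and deleting an element
does not lower it. -/
theorem mem_cyclicFlats_iff_natRk (M : Matroid α) [M.RankFinite] (F : Set α) :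
    F ∈ M.cyclicFlats ↔ F ⊆ M.E ∧ (∀ e ∈ M.E, e ∉ F → M.natRk (insert e F) ≠ M.natRk F) ∧
      ∀ e ∈ F, M.natRk (F \ {e}) = M.natRk F := by
  have key : ∀ e ∈ F, F ⊆ M.E →
      (M.natRk (F \ {e}) = M.natRk F ↔ ∃ C ⊆ F, M.IsCircuit C ∧ e ∈ C) := by
    intro e he hFE
    have h1 := M.natRk_insert_eq_iff (hFE he) (F \ {e})
    rw [mem_closure_iff_exists_isCircuit (by simp), Set.insert_sdiff_singleton,
      Set.insert_eq_of_mem he] at h1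
    rw [← h1, eq_comm]
  constructor
  · rintro ⟨hF, S, hS, rfl⟩
    refine ⟨hF.subset_ground, fun e heE heF h => heF ?_, fun e he => ?_⟩
    · rw [natRk_insert_eq_iff M heE, hF.closure] at h
      exact h
    · rw [key e he hF.subset_ground]
      obtain ⟨C, hC, heC⟩ := he
      exact ⟨C, Set.subset_sUnion_of_mem hC, hS C hC, heC⟩
  · rintro ⟨hFE, hflat, hcyc⟩
    refine ⟨?_, {C | M.IsCircuit C ∧ C ⊆ F}, fun C hC => hC.1, ?_⟩
    · rw [isFlat_iff_closure_eq]
      refine (M.subset_closure F).antisymm' fun e he => by_contra fun heF => ?_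
      have heE := M.closure_subset_ground F he
      exact hflat e heE heF ((M.natRk_insert_eq_iff heE F).2 he)
    · refine Set.Subset.antisymm (fun e he => ?_) (Set.sUnion_subset fun C hC => hC.2)
      obtain ⟨C, hCF, hC, heC⟩ := (key e he hFE).1 (hcyc e he)
      exact ⟨C, ⟨hC, hCF⟩, heC⟩

/-! ### The matroid of a rank function -/

/-- A function on sets that is normalized, has unit increase, and is locally submodular. -/
structure IsRankFunction (ρ : Set α → ℕ) : Prop where
  empty : ρ ∅ = 0
  le_insert : ∀ e S, ρ S ≤ ρ (insert e S)
  insert_le : ∀ e S, ρ (insert e S) ≤ ρ S + 1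
  insert_insert : ∀ e f S, ρ (insert e S) = ρ S → ρ (insert f S) = ρ S →
    ρ (insert e (insert f S)) = ρ S

namespace IsRankFunction

variable {ρ : Set α → ℕ} {S T E : Set α}

theorem le_union (hρ : IsRankFunction ρ) (hT : T.Finite) : ρ S ≤ ρ (S ∪ T) := by
  induction T, hT using Set.Finite.induction_on with
  | empty => simp
  | insert _ _ ih =>
    rw [Set.union_insert]
    exact ih.trans (hρ.le_insert _ _)

theorem mono (hρ : IsRankFunction ρ) (hT : T.Finite) (h : S ⊆ T) : ρ S ≤ ρ T := by
  simpa [Set.union_eq_self_of_subset_left h] using hρ.le_union (S := S) hT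

/-- Elements that do not raise the rank of `S` individually do not raise it together. -/
theorem union_eq (hρ : IsRankFunction ρ) (hT : T.Finite) (h : ∀ e ∈ T, ρ (insert e S) = ρ S) :
    ρ (S ∪ T) = ρ S := by
  -- For the induction, all elements that do not raise the rank of `S` are carried along.
  have key : ∀ f, ρ (insert f S) = ρ S → ρ (insert f (S ∪ T)) = ρ S := by
    induction T, hT using Set.Finite.induction_on with
    | empty => simp
    | @insert a T _ hT ih =>
      intro f hf
      have ih' := ih fun e he => h e (Set.mem_insert_of_mem a he)
      have ha := ih' a (h a (Set.mem_insert a T))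
      have hf' := ih' f hf
      have h1 := hρ.le_insert f (S ∪ T)
      have h2 := hρ.le_union (S := S) hT
      have h0 : ρ (S ∪ T) = ρ S := by omega
      rw [Set.union_insert, ← h0]
      exact hρ.insert_insert f a _ (by omega) (by omega)
  rcases T.eq_empty_or_nonempty with rfl | ⟨t, ht⟩
  · simp
  · have := key t (h t ht)
    rwa [Set.insert_eq_of_mem (Set.mem_union_right _ ht)] at this

theorem le_ncard (hρ : IsRankFunction ρ) (hT : T.Finite) : ρ T ≤ T.ncard := by
  induction T, hT using Set.Finite.induction_on with
  | empty => simp [hρ.empty]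
  | insert ha hT ih =>
    rw [Set.ncard_insert_of_notMem ha hT]
    exact (hρ.insert_le _ _).trans (by omega)

theorem le_add_ncard (hρ : IsRankFunction ρ) (hT : T.Finite) :
    ρ (S ∪ T) ≤ ρ S + T.ncard := by
  induction T, hT using Set.Finite.induction_on with
  | empty => simp
  | insert ha hT ih =>
    rw [Set.ncard_insert_of_notMem ha hT, Set.union_insert]
    exact (hρ.insert_le _ _).trans (by omega)

/-- The matroid on the finite set `E` with rank function `ρ`: a set is independent if its rank is
its size. -/
noncomputable def matroid (hρ : IsRankFunction ρ) (hE : E.Finite) : Matroid α :=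
  (IndepMatroid.ofFinite hE (fun I => I ⊆ E ∧ ρ I = I.ncard)
    ⟨Set.empty_subset E, by simp [hρ.empty]⟩
    (fun I J hJ hIJ => ⟨hIJ.trans hJ.1, by
      have hJfin := hE.subset hJ.1
      have h1 := hρ.le_add_ncard (S := I) (hJfin.subset (Set.sdiff_subset (s := J) (t := I)))
      rw [Set.union_sdiff_cancel hIJ, hJ.2] at h1
      have h2 := hρ.le_ncard (hJfin.subset hIJ)
      have h3 := Set.ncard_sdiff_add_ncard_of_subset hIJ hJfin
      omega⟩)
    (fun I J hI hJ hIJ => by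
      by_contra! hcon
      have hIfin := hE.subset hI.1
      have hJfin := hE.subset hJ.1
      have h : ∀ e ∈ J, ρ (insert e I) = ρ I := by
        intro e he
        by_cases heI : e ∈ I
        · rw [Set.insert_eq_of_mem heI]
        · have h1 := hcon e he heI
          have h2 := hρ.insert_le e I
          have h3 := hρ.le_insert e I
          have h4 : ρ (insert e I) ≠ (insert e I).ncard :=
            fun h5 => h1 (Set.insert_subset (hJ.1 he) hI.1) h5
          rw [Set.ncard_insert_of_notMem heI hIfin, ← hI.2] at h4
          omega
      have h1 := hρ.union_eq hJfin h
      have h2 := hρ.mono (hIfin.union hJfin) (Set.subset_union_right (s := I) (t := J))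
      rw [h1, hI.2, hJ.2] at h2
      omega)
    (fun _ hI => hI.1)).matroid

@[simp] theorem matroid_E (hρ : IsRankFunction ρ) (hE : E.Finite) : (hρ.matroid hE).E = E := rfl

theorem matroid_indep_iff (hρ : IsRankFunction ρ) (hE : E.Finite) {I : Set α} :
    (hρ.matroid hE).Indep I ↔ I ⊆ E ∧ ρ I = I.ncard := Iff.rfl

theorem matroid_finite (hρ : IsRankFunction ρ) (hE : E.Finite) : (hρ.matroid hE).Finite := ⟨hE⟩

theorem natRk_matroid (hρ : IsRankFunction ρ) (hE : E.Finite) {X : Set α} (hX : X ⊆ E) :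
    (hρ.matroid hE).natRk X = ρ X := by
  obtain ⟨I, hI⟩ := (hρ.matroid hE).exists_isBasis X hX
  have hIi := (hρ.matroid_indep_iff hE).1 hI.indep
  have hIfin := hE.subset hIi.1
  have h : ∀ e ∈ X, ρ (insert e I) = ρ I := by
    intro e he
    by_cases heI : e ∈ I
    · rw [Set.insert_eq_of_mem heI]
    · have h2 := hρ.insert_le e I
      have h3 := hρ.le_insert e I
      have h4 : ρ (insert e I) ≠ (insert e I).ncard := fun h5 => heI <|
        hI.mem_of_insert_indep he
          ((hρ.matroid_indep_iff hE).2 ⟨Set.insert_subset (hX he) hIi.1, h5⟩)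
      rw [Set.ncard_insert_of_notMem heI hIfin, ← hIi.2] at h4
      omega
  have h1 := hρ.union_eq (hE.subset hX) h
  rw [Set.union_eq_self_of_subset_left hI.subset, hIi.2] at h1
  rw [natRk, ← hI.encard_eq_eRk, h1, Set.ncard]

end IsRankFunction

/-! ### Shifting a matroid from one element to another -/

open scoped Classical in
/-- The rank function of the shift of `M` from `x` to `y`. It agrees with the rank function of `M`
on the sets that contain both or neither of `x` and `y`; of the two ranks of `Z ∪ {x}` and
`Z ∪ {y}`, it gives the smaller one to `Z ∪ {x}` and the larger one to `Z ∪ {y}`. -/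
noncomputable def shiftRk (M : Matroid α) (x y : α) (S : Set α) : ℕ :=
  if x ∈ S then
    if y ∈ S then M.natRk S else min (M.natRk S) (M.natRk (insert y (S \ {x})))
  else
    if y ∈ S then max (M.natRk S) (M.natRk (insert x (S \ {y}))) else M.natRk S

section Shift

variable {M : Matroid α} {x y : α} {Z S : Set α}

theorem shiftRk_of_notMem (hx : x ∉ Z) (hy : y ∉ Z) : M.shiftRk x y Z = M.natRk Z := by
  simp [shiftRk, hx, hy]

theorem shiftRk_insert_left (hxy : x ≠ y) (hx : x ∉ Z) (hy : y ∉ Z) :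
    M.shiftRk x y (insert x Z) = min (M.natRk (insert x Z)) (M.natRk (insert y Z)) := by
  simp [shiftRk, hx, hy, hxy.symm]

theorem shiftRk_insert_right (hxy : x ≠ y) (hx : x ∉ Z) (hy : y ∉ Z) :
    M.shiftRk x y (insert y Z) = max (M.natRk (insert x Z)) (M.natRk (insert y Z)) := by
  simp [shiftRk, hx, hy, hxy, max_comm]

theorem shiftRk_insert_insert : M.shiftRk x y (insert x (insert y Z)) =
    M.natRk (insert x (insert y Z)) := by
  simp [shiftRk]

theorem exists_insert_form (x y : α) (S : Set α) : ∃ Z, x ∉ Z ∧ y ∉ Z ∧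
    (S = Z ∨ S = insert x Z ∨ S = insert y Z ∨ S = insert x (insert y Z)) := by
  refine ⟨S \ {x, y}, by simp, by simp, ?_⟩
  by_cases hx : x ∈ S <;> by_cases hy : y ∈ S
  · right; right; right
    ext z; by_cases z = x <;> by_cases z = y <;> simp_all
  · right; left
    ext z; by_cases z = x <;> by_cases z = y <;> simp_all
  · right; right; left
    ext z; by_cases z = x <;> by_cases z = y <;> simp_all
  · left
    ext z; by_cases z = x <;> by_cases z = y <;> simp_all

variable (M x y) in
/-- The obstruction to shifting `M` from `x` to `y`: after contracting `Z`, the element `e` is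
parallel to `x` and `f` is parallel to `y`, while `x` and `y` are independent. -/
def IsShiftObstruction (Z : Set α) (e f : α) : Prop :=
  e ≠ x ∧ f ≠ y ∧
  M.natRk (insert x Z) = M.natRk Z + 1 ∧ M.natRk (insert y Z) = M.natRk Z + 1 ∧
  M.natRk (insert e (insert x Z)) = M.natRk Z + 1 ∧
  M.natRk (insert f (insert y Z)) = M.natRk Z + 1 ∧
  M.natRk (insert e (insert y Z)) = M.natRk Z + 2 ∧
  M.natRk (insert f (insert x Z)) = M.natRk Z + 2

theorem shiftRk_insert_bounds [M.RankFinite] (hxy : x ≠ y) (e : α) (S : Set α) :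
    M.shiftRk x y S ≤ M.shiftRk x y (insert e S) ∧
      M.shiftRk x y (insert e S) ≤ M.shiftRk x y S + 1 := by
  obtain ⟨Z, hx, hy, hS⟩ := exists_insert_form x y S
  have step : ∀ a T, M.natRk T ≤ M.natRk (insert a T) ∧ M.natRk (insert a T) ≤ M.natRk T + 1 :=
    fun a T => ⟨M.natRk_le_insert a T, M.natRk_insert_le a T⟩
  have hZx := step x Z
  have hZy := step y Z
  have hZxy := step x (insert y Z)
  have hZyx := step y (insert x Z)
  rw [Set.insert_comm] at hZyx
  by_cases hex : e = x
  · subst hex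
    rcases hS with rfl | rfl | rfl | rfl <;>
    simp only [Set.insert_idem, shiftRk_of_notMem hx hy,
      shiftRk_insert_left hxy hx hy, shiftRk_insert_right hxy hx hy, shiftRk_insert_insert] <;>
    omega
  by_cases hey : e = y
  · subst hey
    rcases hS with rfl | rfl | rfl | rfl <;>
    simp only [Set.insert_comm e x, Set.insert_idem, shiftRk_of_notMem hx hy,
      shiftRk_insert_left hxy hx hy, shiftRk_insert_right hxy hx hy, shiftRk_insert_insert] <;>
    omega
  · have hex' : x ∉ insert e Z := by simp [Ne.symm hex, hx]
    have hey' : y ∉ insert e Z := by simp [Ne.symm hey, hy]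
    have hZe := step e Z
    have hZxe := step e (insert x Z)
    have hZye := step e (insert y Z)
    have hZxye := step e (insert x (insert y Z))
    simp only [Set.insert_comm e x, Set.insert_comm e y] at hZxe hZye hZxye
    rcases hS with rfl | rfl | rfl | rfl <;>
    simp only [Set.insert_comm e x, Set.insert_comm e y, shiftRk_of_notMem hx hy,
      shiftRk_insert_left hxy hx hy, shiftRk_insert_right hxy hx hy, shiftRk_insert_insert,
      shiftRk_of_notMem hex' hey', shiftRk_insert_left hxy hex' hey',
      shiftRk_insert_right hxy hex' hey'] <;>
    omega

theorem shiftRk_insert_insert_left [M.RankFinite] (hxy : x ≠ y) (g : α) (S : Set α)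
    (h1 : M.shiftRk x y (insert x S) = M.shiftRk x y S)
    (h2 : M.shiftRk x y (insert g S) = M.shiftRk x y S) :
    M.shiftRk x y (insert x (insert g S)) = M.shiftRk x y S := by
  obtain ⟨Z, hx, hy, hS⟩ := exists_insert_form x y S
  by_cases hgx : g = x
  · rw [hgx, Set.insert_idem, h1]
  have hZxy := M.natRk_submod x y Z
  have hZx' := M.natRk_le_insert x (insert y Z)
  have hZy' := M.natRk_le_insert y (insert x Z)
  rw [Set.insert_comm] at hZy'
  by_cases hgy : g = y
  · subst hgy
    rcases hS with rfl | rfl | rfl | rfl <;>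
    simp only [Set.insert_comm g x, Set.insert_idem, shiftRk_of_notMem hx hy,
      shiftRk_insert_left hxy hx hy, shiftRk_insert_right hxy hx hy,
      shiftRk_insert_insert] at h1 h2 ⊢ <;>
    omega
  · have hgx' : x ∉ insert g Z := by simp [Ne.symm hgx, hx]
    have hgy' : y ∉ insert g Z := by simp [Ne.symm hgy, hy]
    have s1 := M.natRk_submod g x Z
    have s2 := M.natRk_submod g y Z
    have s3 := M.natRk_submod g x (insert y Z)
    have s4 := M.natRk_submod g y (insert x Z)
    have s5 := M.natRk_le_insert x (insert g Z)
    have s6 := M.natRk_le_insert y (insert g Z)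
    have s7 := M.natRk_le_insert y (insert x (insert g Z))
    have s8 := M.natRk_le_insert x (insert y (insert g Z))
    simp only [Set.insert_comm g x, Set.insert_comm g y, Set.insert_comm y x]
      at s1 s2 s3 s4 s5 s6 s7 s8
    rcases hS with rfl | rfl | rfl | rfl <;>
    simp only [Set.insert_comm g x, Set.insert_comm g y, Set.insert_idem, shiftRk_of_notMem hx hy,
      shiftRk_insert_left hxy hx hy, shiftRk_insert_right hxy hx hy, shiftRk_insert_insert,
      shiftRk_of_notMem hgx' hgy', shiftRk_insert_left hxy hgx' hgy',
      shiftRk_insert_right hxy hgx' hgy'] at h1 h2 ⊢ <;>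
    omega

theorem shiftRk_insert_insert_right [M.RankFinite] (hxy : x ≠ y) (g : α) (S : Set α)
    (h1 : M.shiftRk x y (insert y S) = M.shiftRk x y S)
    (h2 : M.shiftRk x y (insert g S) = M.shiftRk x y S) :
    M.shiftRk x y (insert y (insert g S)) = M.shiftRk x y S := by
  obtain ⟨Z, hx, hy, hS⟩ := exists_insert_form x y S
  by_cases hgy : g = y
  · rw [hgy, Set.insert_idem, h1]
  by_cases hgx : g = x
  · rw [hgx, Set.insert_comm]
    rw [hgx] at h2
    exact shiftRk_insert_insert_left hxy y S h2 h1
  have hgx' : x ∉ insert g Z := by simp [Ne.symm hgx, hx]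
  have hgy' : y ∉ insert g Z := by simp [Ne.symm hgy, hy]
  have hZx' := M.natRk_le_insert x (insert y Z)
  have hZy' := M.natRk_le_insert y (insert x Z)
  have s1 := M.natRk_submod g x Z
  have s2 := M.natRk_submod g y Z
  have s3 := M.natRk_submod g x (insert y Z)
  have s4 := M.natRk_submod g y (insert x Z)
  have s6 := M.natRk_le_insert y (insert g Z)
  have s8 := M.natRk_le_insert x (insert y (insert g Z))
  simp only [Set.insert_comm g x, Set.insert_comm g y, Set.insert_comm y x]
    at s1 s2 s3 s4 s6 s8 hZy'
  rcases hS with rfl | rfl | rfl | rfl <;>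
  simp only [Set.insert_comm g x, Set.insert_comm g y, Set.insert_comm y x, Set.insert_idem,
    shiftRk_of_notMem hx hy,
    shiftRk_insert_left hxy hx hy, shiftRk_insert_right hxy hx hy, shiftRk_insert_insert,
    shiftRk_of_notMem hgx' hgy', shiftRk_insert_left hxy hgx' hgy',
    shiftRk_insert_right hxy hgx' hgy'] at h1 h2 ⊢ <;>
  omega

/-- Local submodularity of the shifted rank can fail only at a set `Z ∪ {x}`, and then contracting
`Z` exhibits an obstruction. -/
theorem isRankFunction_shiftRk [M.RankFinite] (hxy : x ≠ y)
    (h : ∀ Z e f, ¬ M.IsShiftObstruction x y Z e f) : IsRankFunction (M.shiftRk x y) where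
  empty := by simp [shiftRk, natRk_empty]
  le_insert e S := (shiftRk_insert_bounds hxy e S).1
  insert_le e S := (shiftRk_insert_bounds hxy e S).2
  insert_insert e f S := by
    intro h1 h2
    by_cases hex : e = x
    · subst hex; exact shiftRk_insert_insert_left hxy f S h1 h2
    by_cases hfx : f = x
    · subst hfx; rw [Set.insert_comm]; exact shiftRk_insert_insert_left hxy e S h2 h1
    by_cases hey : e = y
    · subst hey; exact shiftRk_insert_insert_right hxy f S h1 h2
    by_cases hfy : f = y
    · subst hfy; rw [Set.insert_comm]; exact shiftRk_insert_insert_right hxy e S h2 h1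
    obtain ⟨Z, hx, hy, hS⟩ := exists_insert_form x y S
    have hex' : x ∉ insert e Z := by simp [Ne.symm hex, hx]
    have hey' : y ∉ insert e Z := by simp [Ne.symm hey, hy]
    have hfx' : x ∉ insert f Z := by simp [Ne.symm hfx, hx]
    have hfy' : y ∉ insert f Z := by simp [Ne.symm hfy, hy]
    have hefx : x ∉ insert e (insert f Z) := by simp [Ne.symm hex, hfx']
    have hefy : y ∉ insert e (insert f Z) := by simp [Ne.symm hey, hfy']
    have h3 := h Z e f
    have h4 := h Z f e
    simp only [IsShiftObstruction, ne_eq, hex, hey, hfx, hfy, not_false_eq_true, true_and] at h3 h4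
    have a1 := M.natRk_insert_le x Z
    have a2 := M.natRk_insert_le y Z
    have s1 := M.natRk_submod e f Z
    have s2 := M.natRk_submod e f (insert x Z)
    have s3 := M.natRk_submod e f (insert y Z)
    have s4 := M.natRk_submod e f (insert x (insert y Z))
    have s5 := M.natRk_submod e x Z
    have s6 := M.natRk_submod e y Z
    have s7 := M.natRk_submod f x Z
    have s8 := M.natRk_submod f y Z
    have c1 := M.natRk_le_insert x (insert e Z)
    have c2 := M.natRk_le_insert y (insert e Z)
    have d1 := M.natRk_le_insert x (insert e (insert f Z))
    have d2 := M.natRk_le_insert y (insert e (insert f Z))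
    have d3 := M.natRk_le_insert e (insert f (insert x Z))
    have d4 := M.natRk_le_insert e (insert f (insert y Z))
    have d7 := M.natRk_le_insert e (insert f (insert x (insert y Z)))
    have d5 := M.natRk_submod x e (insert f Z)
    have d6 := M.natRk_submod y e (insert f Z)
    simp only [Set.insert_comm e x, Set.insert_comm e y, Set.insert_comm f x, Set.insert_comm f y]
      at h3 h4 s1 s2 s3 s4 s5 s6 s7 s8 d3 d4 d7
    rcases hS with rfl | rfl | rfl | rfl <;>
    simp only [Set.insert_comm e x, Set.insert_comm e y, Set.insert_comm f x, Set.insert_comm f y,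
      shiftRk_of_notMem hx hy,
      shiftRk_insert_left hxy hx hy, shiftRk_insert_right hxy hx hy, shiftRk_insert_insert,
      shiftRk_of_notMem hex' hey', shiftRk_insert_left hxy hex' hey',
      shiftRk_insert_right hxy hex' hey', shiftRk_of_notMem hfx' hfy',
      shiftRk_insert_left hxy hfx' hfy', shiftRk_insert_right hxy hfx' hfy',
      shiftRk_of_notMem hefx hefy, shiftRk_insert_left hxy hefx hefy,
      shiftRk_insert_right hxy hefx hefy] at h1 h2 ⊢ <;>
    omega

end Shift
/-! ### Cyclic flats of a shift -/

section CyclicFlats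

variable {M N : Matroid α} {x y e : α} {Z F G E : Set α}

/-- The rank conditions that single out the cyclic flats among the subsets of `E`. -/
def IsCyclicFlatOf (ρ : Set α → ℕ) (E F : Set α) : Prop :=
  F ⊆ E ∧ (∀ e ∈ E, e ∉ F → ρ (insert e F) ≠ ρ F) ∧ ∀ e ∈ F, ρ (F \ {e}) = ρ F

theorem isCyclicFlatOf_iff_of_notMem {ρ : Set α → ℕ} (hxE : x ∈ E) (hyE : y ∈ E)
    (hx : x ∉ Z) (hy : y ∉ Z) : IsCyclicFlatOf ρ E Z ↔
      Z ⊆ E ∧ ρ (insert x Z) ≠ ρ Z ∧ ρ (insert y Z) ≠ ρ Z ∧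
        (∀ e ∈ E, e ∉ Z → e ≠ x → e ≠ y → ρ (insert e Z) ≠ ρ Z) ∧
        ∀ e ∈ Z, ρ (Z \ {e}) = ρ Z := by
  constructor
  · rintro ⟨h1, h2, h3⟩
    exact ⟨h1, h2 x hxE hx, h2 y hyE hy, fun e he heZ _ _ => h2 e he heZ, h3⟩
  · rintro ⟨h1, h2, h3, h4, h5⟩
    refine ⟨h1, fun e he heZ => ?_, h5⟩
    by_cases hex : e = x
    · rwa [hex]
    by_cases hey : e = y
    · rwa [hey]
    exact h4 e he heZ hex hey

theorem isCyclicFlatOf_insert_iff {ρ : Set α → ℕ} (hxy : x ≠ y) (hxE : x ∈ E) (hyE : y ∈ E)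
    (hx : x ∉ Z) (hy : y ∉ Z) : IsCyclicFlatOf ρ E (insert x Z) ↔
      Z ⊆ E ∧ ρ (insert x (insert y Z)) ≠ ρ (insert x Z) ∧
        (∀ e ∈ E, e ∉ Z → e ≠ x → e ≠ y → ρ (insert x (insert e Z)) ≠ ρ (insert x Z)) ∧
        ρ Z = ρ (insert x Z) ∧ ∀ e ∈ Z, ρ (insert x (Z \ {e})) = ρ (insert x Z) := by
  have hdel : ∀ e ∈ Z, insert x Z \ {e} = insert x (Z \ {e}) := fun e he =>
    Set.insert_sdiff_of_notMem _ (by rintro rfl; exact hx he)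
  constructor
  · rintro ⟨h1, h2, h3⟩
    refine ⟨(Set.subset_insert _ _).trans h1, ?_, fun e he heZ hex hey => ?_, ?_,
      fun e he => ?_⟩
    · rw [Set.insert_comm]
      exact h2 y hyE (by simp [hxy.symm, hy])
    · rw [Set.insert_comm]
      exact h2 e he (by simp [hex, heZ])
    · rw [← h3 x (Set.mem_insert x Z), Set.insert_sdiff_self_of_notMem hx]
    · rw [← hdel e he]
      exact h3 e (Set.mem_insert_of_mem x he)
  · rintro ⟨h1, h2, h3, h4, h5⟩
    refine ⟨Set.insert_subset hxE h1, fun e he heZ => ?_, fun e he => ?_⟩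
    · rw [Set.insert_comm]
      by_cases hey : e = y
      · rwa [hey]
      · exact h3 e he (fun h => heZ (Set.mem_insert_of_mem x h))
          (fun h => heZ (h ▸ Set.mem_insert x Z)) hey
    · rcases he with rfl | he
      · rw [Set.insert_sdiff_self_of_notMem hx, h4]
      · rw [hdel e he, h5 e he]

theorem isCyclicFlatOf_insert_insert_iff {ρ : Set α → ℕ} (hxy : x ≠ y) (hxE : x ∈ E)
    (hyE : y ∈ E) (hx : x ∉ Z) (hy : y ∉ Z) :
    IsCyclicFlatOf ρ E (insert x (insert y Z)) ↔
      Z ⊆ E ∧ (∀ e ∈ E, e ∉ Z → e ≠ x → e ≠ y →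
        ρ (insert x (insert y (insert e Z))) ≠ ρ (insert x (insert y Z))) ∧
        ρ (insert x Z) = ρ (insert x (insert y Z)) ∧
        ρ (insert y Z) = ρ (insert x (insert y Z)) ∧
        ∀ e ∈ Z, ρ (insert x (insert y (Z \ {e}))) = ρ (insert x (insert y Z)) := by
  have hdel : ∀ e ∈ Z, insert x (insert y Z) \ {e} = insert x (insert y (Z \ {e})) := by
    intro e he
    rw [Set.insert_sdiff_of_notMem _ (by rintro rfl; exact hx he),
      Set.insert_sdiff_of_notMem _ (by rintro rfl; exact hy he)]
  have hdelx : insert x (insert y Z) \ {x} = insert y Z :=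
    Set.insert_sdiff_self_of_notMem (by simp [hxy, hx])
  have hdely : insert x (insert y Z) \ {y} = insert x Z := by
    rw [Set.insert_comm]
    exact Set.insert_sdiff_self_of_notMem (by simp [hxy.symm, hy])
  constructor
  · rintro ⟨h1, h2, h3⟩
    refine ⟨(Set.subset_insert _ _).trans ((Set.subset_insert _ _).trans h1),
      fun e he heZ hex hey => ?_, ?_, ?_, fun e he => ?_⟩
    · rw [Set.insert_comm y e, Set.insert_comm x e]
      exact h2 e he (by simp [hex, hey, heZ])
    · rw [← h3 y (by simp), hdely]
    · rw [← h3 x (by simp), hdelx]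
    · rw [← hdel e he]
      exact h3 e (by simp [he])
  · rintro ⟨h1, h2, h3, h4, h5⟩
    refine ⟨Set.insert_subset hxE (Set.insert_subset hyE h1), fun e he heZ => ?_,
      fun e he => ?_⟩
    · simp only [Set.mem_insert_iff, not_or] at heZ
      rw [Set.insert_comm e x, Set.insert_comm e y]
      exact h2 e he heZ.2.2 heZ.1 heZ.2.1
    · rcases he with rfl | rfl | he
      · rw [hdelx, h4]
      · rw [hdely, h3]
      · rw [hdel e he, h5 e he]

/-- `N` is the shift of `M` from `x` to `y`: it has the same ground set and the shifted rank. -/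
structure IsShift (M N : Matroid α) (x y : α) : Prop where
  ne : x ≠ y
  left_mem : x ∈ M.E
  right_mem : y ∈ M.E
  ground_eq : N.E = M.E
  natRk_eq : ∀ X ⊆ M.E, N.natRk X = M.shiftRk x y X

theorem mem_cyclicFlats_iff [M.RankFinite] :
    F ∈ M.cyclicFlats ↔ IsCyclicFlatOf M.natRk M.E F :=
  M.mem_cyclicFlats_iff_natRk F

/-- A cyclic flat is spanned by all but one of its elements, so a flat that contains these contains
the whole cyclic flat. -/
theorem subset_of_diff_singleton_subset (hF : F ∈ M.cyclicFlats) (hG : G ∈ M.cyclicFlats)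
    (h : F \ {e} ⊆ G) : F ⊆ G := by
  intro z hz
  by_cases hze : z = e
  · subst hze
    obtain ⟨-, S, hS, rfl⟩ := hF
    obtain ⟨C, hC, hzC⟩ := hz
    have h1 := (hS C hC).mem_closure_sdiff_singleton_of_mem hzC
    have h2 := M.closure_subset_closure
      ((Set.sdiff_subset_sdiff_left (Set.subset_sUnion_of_mem hC)).trans h) h1
    rwa [hG.1.closure] at h2
  · exact h ⟨hz, hze⟩

namespace IsShift

theorem mem_cyclicFlats_right_iff [N.RankFinite] (h : IsShift M N x y) :
    F ∈ N.cyclicFlats ↔ IsCyclicFlatOf (M.shiftRk x y) M.E F := by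
  rw [mem_cyclicFlats_iff, h.ground_eq]
  unfold IsCyclicFlatOf
  refine and_congr_right fun hF => and_congr ?_ ?_
  · refine forall₂_congr fun e he => ?_
    rw [h.natRk_eq _ hF, h.natRk_eq _ (Set.insert_subset he hF)]
  · refine forall₂_congr fun e he => ?_
    rw [h.natRk_eq _ hF, h.natRk_eq _ (Set.sdiff_subset.trans hF)]

variable [M.RankFinite] [N.RankFinite]

theorem mem_cyclicFlats_iff_of_notMem (h : IsShift M N x y) (hx : x ∉ Z) (hy : y ∉ Z) :
    Z ∈ N.cyclicFlats ↔ Z ∈ M.cyclicFlats := by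
  rw [h.mem_cyclicFlats_right_iff, mem_cyclicFlats_iff,
    isCyclicFlatOf_iff_of_notMem h.left_mem h.right_mem hx hy,
    isCyclicFlatOf_iff_of_notMem h.left_mem h.right_mem hx hy,
    shiftRk_insert_left h.ne hx hy, shiftRk_insert_right h.ne hx hy, shiftRk_of_notMem hx hy]
  have h3 : (∀ e ∈ M.E, e ∉ Z → e ≠ x → e ≠ y → M.shiftRk x y (insert e Z) ≠ M.natRk Z) ↔
      ∀ e ∈ M.E, e ∉ Z → e ≠ x → e ≠ y → M.natRk (insert e Z) ≠ M.natRk Z := by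
    refine forall₅_congr fun e _ _ hex hey => ?_
    rw [shiftRk_of_notMem (by simp [hx, Ne.symm hex]) (by simp [hy, Ne.symm hey])]
  have h4 : (∀ e ∈ Z, M.shiftRk x y (Z \ {e}) = M.natRk Z) ↔
      ∀ e ∈ Z, M.natRk (Z \ {e}) = M.natRk Z := by
    refine forall₂_congr fun e _ => ?_
    rw [shiftRk_of_notMem (fun hh => hx hh.1) (fun hh => hy hh.1)]
  rw [h3, h4]
  refine and_congr_right fun _ => ⟨fun ⟨a, b, c⟩ => ⟨by omega, by omega, c⟩,
    fun ⟨a, b, c⟩ => ⟨by omega, by omega, c⟩⟩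

theorem insert_insert_mem_cyclicFlats_iff (h : IsShift M N x y) (hx : x ∉ Z) (hy : y ∉ Z) :
    insert x (insert y Z) ∈ N.cyclicFlats ↔ insert x (insert y Z) ∈ M.cyclicFlats := by
  rw [h.mem_cyclicFlats_right_iff, mem_cyclicFlats_iff,
    isCyclicFlatOf_insert_insert_iff h.ne h.left_mem h.right_mem hx hy,
    isCyclicFlatOf_insert_insert_iff h.ne h.left_mem h.right_mem hx hy,
    shiftRk_insert_left h.ne hx hy, shiftRk_insert_right h.ne hx hy]
  simp only [shiftRk_insert_insert]
  have h2 := M.natRk_le_insert y (insert x Z)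
  rw [Set.insert_comm] at h2
  exact and_congr_right fun _ => and_congr_right fun _ =>
    ⟨fun ⟨a, b, c⟩ => ⟨by omega, by omega, c⟩, fun ⟨a, b, c⟩ => ⟨by omega, by omega, c⟩⟩

/-- A cyclic flat `Z ∪ {x}` of the shift comes from exactly one of `Z ∪ {x}` and `Z ∪ {y}`: both
cannot be cyclic flats of `M`, since then each would contain the other's additional element. -/
theorem insert_left_mem_cyclicFlats_iff (h : IsShift M N x y) (hx : x ∉ Z) (hy : y ∉ Z) :
    insert x Z ∈ N.cyclicFlats ↔ insert x Z ∈ M.cyclicFlats ∨ insert y Z ∈ M.cyclicFlats := by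
  have hiff : insert x Z ∈ N.cyclicFlats ↔ Z ⊆ M.E ∧
      M.natRk (insert x (insert y Z)) ≠
        min (M.natRk (insert x Z)) (M.natRk (insert y Z)) ∧
      (∀ e ∈ M.E, e ∉ Z → e ≠ x → e ≠ y →
        min (M.natRk (insert x (insert e Z))) (M.natRk (insert y (insert e Z))) ≠
          min (M.natRk (insert x Z)) (M.natRk (insert y Z))) ∧
      M.natRk Z = min (M.natRk (insert x Z)) (M.natRk (insert y Z)) ∧
      ∀ e ∈ Z, min (M.natRk (insert x (Z \ {e}))) (M.natRk (insert y (Z \ {e}))) =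
          min (M.natRk (insert x Z)) (M.natRk (insert y Z)) := by
    rw [h.mem_cyclicFlats_right_iff, isCyclicFlatOf_insert_iff h.ne h.left_mem h.right_mem hx hy,
      shiftRk_insert_left h.ne hx hy, shiftRk_of_notMem hx hy, shiftRk_insert_insert]
    refine and_congr_right fun _ => and_congr_right fun _ => and_congr ?_ (and_congr_right
      fun _ => ?_)
    · refine forall₅_congr fun e _ _ hex hey => ?_
      rw [shiftRk_insert_left h.ne (by simp [hx, Ne.symm hex]) (by simp [hy, Ne.symm hey])]
    · refine forall₂_congr fun e _ => ?_
      rw [shiftRk_insert_left h.ne (fun hh => hx hh.1) (fun hh => hy hh.1)]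
  rw [hiff, mem_cyclicFlats_iff, mem_cyclicFlats_iff,
    isCyclicFlatOf_insert_iff h.ne h.left_mem h.right_mem hx hy,
    isCyclicFlatOf_insert_iff h.ne.symm h.right_mem h.left_mem hy hx, Set.insert_comm y x]
  have b5 := M.natRk_submod x y Z
  have b6 := M.natRk_le_insert x (insert y Z)
  have b7 := M.natRk_le_insert y (insert x Z)
  rw [Set.insert_comm] at b7
  have hadd : ∀ e, M.natRk Z ≤ M.natRk (insert x (insert e Z)) ∧
      M.natRk (insert x Z) ≤ M.natRk (insert x (insert e Z)) ∧
      M.natRk (insert y Z) ≤ M.natRk (insert y (insert e Z)) := fun e =>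
    ⟨M.natRk_mono (fun z hz => by simp [hz]),
      M.natRk_mono (Set.insert_subset_insert (Set.subset_insert _ _)),
      M.natRk_mono (Set.insert_subset_insert (Set.subset_insert _ _))⟩
  have hdel : ∀ e ∈ Z,
      M.natRk (Z \ {e}) + M.natRk (insert x Z) ≤ M.natRk (insert x (Z \ {e})) + M.natRk Z ∧
      M.natRk (Z \ {e}) + M.natRk (insert y Z) ≤ M.natRk (insert y (Z \ {e})) + M.natRk Z ∧
      M.natRk Z ≤ M.natRk (Z \ {e}) + 1 ∧
      M.natRk (insert x (Z \ {e})) ≤ M.natRk (insert x Z) ∧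
      M.natRk (insert y (Z \ {e})) ≤ M.natRk (insert y Z) := by
    intro e he
    have hZ : insert e (Z \ {e}) = Z := by rw [Set.insert_sdiff_singleton, Set.insert_eq_of_mem he]
    have s1 := M.natRk_submod x e (Z \ {e})
    have s2 := M.natRk_submod y e (Z \ {e})
    have s3 := M.natRk_insert_le e (Z \ {e})
    rw [hZ] at s1 s2 s3
    exact ⟨s1, s2, s3, M.natRk_mono (Set.insert_subset_insert Set.sdiff_subset),
      M.natRk_mono (Set.insert_subset_insert Set.sdiff_subset)⟩
  constructor
  · rintro ⟨h1, h2, h3, h4, h5⟩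
    by_cases hc : M.natRk (insert x Z) = M.natRk Z
    · refine Or.inl ⟨h1, by omega, fun e he heZ hex hey => ?_, hc.symm, fun e he => ?_⟩
      · have := h3 e he heZ hex hey
        have := hadd e
        omega
      · have := h5 e he
        have := hdel e he
        omega
    · refine Or.inr ⟨h1, by omega, fun e he heZ hey hex => ?_, by omega, fun e he => ?_⟩
      · have := h3 e he heZ hex hey
        have := hadd e
        omega
      · have := h5 e he
        have := hdel e he
        omega
  · rintro (⟨h1, h2, h3, h4, h5⟩ | ⟨h1, h2, h3, h4, h5⟩)
    all_goals
      refine ⟨h1, by omega, fun e he heZ hex hey => ?_, by omega, fun e he => ?_⟩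
      · first
        | have := h3 e he heZ hex hey
          have := hadd e
          omega
        | have := h3 e he heZ hey hex
          have := hadd e
          omega
      · have := h5 e he
        have := hdel e he
        omega

theorem insert_right_notMem_cyclicFlats (h : IsShift M N x y) (hx : x ∉ Z) (hy : y ∉ Z) :
    insert y Z ∉ N.cyclicFlats := by
  rw [h.mem_cyclicFlats_right_iff,
    isCyclicFlatOf_insert_iff h.ne.symm h.right_mem h.left_mem hy hx,
    shiftRk_insert_right h.ne hx hy, shiftRk_of_notMem hx hy, Set.insert_comm y x,
    shiftRk_insert_insert]
  rintro ⟨-, h2, -, h4, -⟩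
  have b2 := M.natRk_le_insert y Z
  have b5 := M.natRk_submod x y Z
  have b6 := M.natRk_le_insert x (insert y Z)
  omega

end IsShift

end CyclicFlats

/-! ### The configuration of a shift -/

section Configuration

variable {M N : Matroid α} {x y e : α} {Z F G : Set α}

open scoped Classical in
/-- The image of a set under the shift: `y` is replaced by `x` in a set that contains `y` and not
`x`, and any other set is left as it is. -/
noncomputable def shiftSet (x y : α) (F : Set α) : Set α :=
  if y ∈ F ∧ x ∉ F then insert x (F \ {y}) else F

theorem shiftSet_insert_right (hxy : x ≠ y) (hx : x ∉ Z) (hy : y ∉ Z) :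
    shiftSet x y (insert y Z) = insert x Z := by
  simp [shiftSet, hxy, hx, hy]

theorem shiftSet_of_notMem (hy : y ∉ F) : shiftSet x y F = F := by
  simp [shiftSet, hy]

theorem shiftSet_of_mem (hx : x ∈ F) : shiftSet x y F = F := by
  simp [shiftSet, hx]

theorem left_mem_shiftSet_iff : x ∈ shiftSet x y F ↔ x ∈ F ∨ y ∈ F := by
  unfold shiftSet
  split_ifs with h
  · simp [h.1]
  · tauto

theorem right_mem_shiftSet_iff (hxy : x ≠ y) : y ∈ shiftSet x y F ↔ x ∈ F ∧ y ∈ F := by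
  unfold shiftSet
  split_ifs with h
  · simp [h.2, hxy.symm]
  · tauto

theorem mem_shiftSet_iff (hx : e ≠ x) (hy : e ≠ y) : e ∈ shiftSet x y F ↔ e ∈ F := by
  unfold shiftSet
  split_ifs with h
  · simp [hx, hy]
  · rfl

theorem encard_shiftSet (x y : α) (F : Set α) : (shiftSet x y F).encard = F.encard := by
  unfold shiftSet
  split_ifs with h
  · exact Set.encard_exchange h.2 h.1
  · rfl

namespace IsShift

theorem mem_cyclicFlats_iff_exists [M.RankFinite] [N.RankFinite] (h : IsShift M N x y) :
    G ∈ N.cyclicFlats ↔ ∃ F ∈ M.cyclicFlats, shiftSet x y F = G := by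
  constructor
  · intro hG
    obtain ⟨Z, hx, hy, rfl | rfl | rfl | rfl⟩ := exists_insert_form x y G
    · exact ⟨G, (h.mem_cyclicFlats_iff_of_notMem hx hy).1 hG, shiftSet_of_notMem hy⟩
    · rcases (h.insert_left_mem_cyclicFlats_iff hx hy).1 hG with hM | hM
      · exact ⟨_, hM, shiftSet_of_mem (Set.mem_insert x Z)⟩
      · exact ⟨_, hM, shiftSet_insert_right h.ne hx hy⟩
    · exact absurd hG (h.insert_right_notMem_cyclicFlats hx hy)
    · exact ⟨_, (h.insert_insert_mem_cyclicFlats_iff hx hy).1 hG,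
        shiftSet_of_mem (Set.mem_insert x _)⟩
  · rintro ⟨F, hF, rfl⟩
    obtain ⟨Z, hx, hy, rfl | rfl | rfl | rfl⟩ := exists_insert_form x y F
    · rw [shiftSet_of_notMem hy]
      exact (h.mem_cyclicFlats_iff_of_notMem hx hy).2 hF
    · rw [shiftSet_of_mem (Set.mem_insert x Z)]
      exact (h.insert_left_mem_cyclicFlats_iff hx hy).2 (Or.inl hF)
    · rw [shiftSet_insert_right h.ne hx hy]
      exact (h.insert_left_mem_cyclicFlats_iff hx hy).2 (Or.inr hF)
    · rw [shiftSet_of_mem (Set.mem_insert x _)]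
      exact (h.insert_insert_mem_cyclicFlats_iff hx hy).2 hF

theorem shiftSet_subset_shiftSet_iff (h : IsShift M N x y) (hF : F ∈ M.cyclicFlats)
    (hG : G ∈ M.cyclicFlats) : shiftSet x y F ⊆ shiftSet x y G ↔ F ⊆ G := by
  have hxy := h.ne
  constructor
  · intro hsub
    -- At most one element of `F` can be missing from `G` a priori, and the rest of `F` spans it.
    by_cases hx : x ∈ F
    · refine subset_of_diff_singleton_subset (e := x) hF hG fun z hz => ?_
      have hz' := hsub ((shiftSet_of_mem hx).symm ▸ hz.1)
      by_cases hzy : z = y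
      · subst hzy
        exact ((right_mem_shiftSet_iff hxy).1 hz').2
      · exact (mem_shiftSet_iff hz.2 hzy).1 hz'
    · refine subset_of_diff_singleton_subset (e := y) hF hG fun z hz => ?_
      have hzx : z ≠ x := by rintro rfl; exact hx hz.1
      exact (mem_shiftSet_iff hzx hz.2).1 (hsub ((mem_shiftSet_iff hzx hz.2).2 hz.1))
  · intro hsub z hz
    by_cases hzx : z = x
    · subst hzx
      exact left_mem_shiftSet_iff.2 ((left_mem_shiftSet_iff.1 hz).imp (@hsub _) (@hsub _))
    by_cases hzy : z = y
    · subst hzy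
      exact (right_mem_shiftSet_iff hxy).2
        (((right_mem_shiftSet_iff hxy).1 hz).imp (@hsub _) (@hsub _))
    · exact (mem_shiftSet_iff hzx hzy).2 (hsub ((mem_shiftSet_iff hzx hzy).1 hz))

theorem natRk_shiftSet [M.RankFinite] (h : IsShift M N x y) (hF : F ∈ M.cyclicFlats) :
    N.natRk (shiftSet x y F) = M.natRk F := by
  have hFE : F ⊆ M.E := hF.1.subset_ground
  have hF' := Matroid.mem_cyclicFlats_iff.1 hF
  obtain ⟨Z, hx, hy, rfl | rfl | rfl | rfl⟩ := exists_insert_form x y F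
  · rw [shiftSet_of_notMem hy, h.natRk_eq _ hFE, shiftRk_of_notMem hx hy]
  · rw [shiftSet_of_mem (Set.mem_insert x Z), h.natRk_eq _ hFE, shiftRk_insert_left h.ne hx hy]
    have h1 := ((isCyclicFlatOf_insert_iff h.ne h.left_mem h.right_mem hx hy).1 hF').2.2.2.1
    have h2 := M.natRk_le_insert y Z
    omega
  · rw [shiftSet_insert_right h.ne hx hy,
      h.natRk_eq _ (Set.insert_subset h.left_mem ((Set.subset_insert _ _).trans hFE)),
      shiftRk_insert_left h.ne hx hy]
    have h1 := ((isCyclicFlatOf_insert_iff h.ne.symm h.right_mem h.left_mem hy hx).1 hF').2.2.2.1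
    have h2 := M.natRk_le_insert x Z
    omega
  · rw [shiftSet_of_mem (Set.mem_insert x _), h.natRk_eq _ hFE, shiftRk_insert_insert]

/-- Replacing `y` by `x` in the cyclic flats that contain `y` and not `x` is an isomorphism from the
lattice of cyclic flats of `M` to that of its shift. -/
theorem haveSameConfiguration [M.RankFinite] [N.RankFinite] (h : IsShift M N x y) :
    M.HaveSameConfiguration N := by
  refine ⟨by rw [h.ground_eq], ?_⟩
  let f : M.cyclicFlats ↪o N.cyclicFlats := OrderEmbedding.ofMapLEIff
    (fun F => ⟨shiftSet x y F, h.mem_cyclicFlats_iff_exists.2 ⟨F, F.2, rfl⟩⟩)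
    (fun F G => h.shiftSet_subset_shiftSet_iff F.2 G.2)
  have hf : Function.Surjective f := by
    rintro ⟨G, hG⟩
    obtain ⟨F, hF, hFG⟩ := h.mem_cyclicFlats_iff_exists.1 hG
    exact ⟨⟨F, hF⟩, Subtype.ext hFG⟩
  refine ⟨RelIso.ofSurjective f hf, fun F => ⟨encard_shiftSet x y F, ?_⟩⟩
  rw [← coe_natRk, ← coe_natRk]
  exact congrArg _ (h.natRk_shiftSet F.2)

end IsShift

end Configuration

/-! ### Counting the cyclic flats that contain an element -/

section Degree

variable {M N : Matroid α} {x y e : α} {F G : Set α}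

/-- The number of cyclic flats of `M` that contain `e`. -/
noncomputable def cyclicDegree (M : Matroid α) (e : α) : ℕ := {F ∈ M.cyclicFlats | e ∈ F}.ncard

/-- The sum of the squares of the cyclic degrees of the elements of `M`. Counting by pairs of cyclic
flats, it is the sum of the sizes of their intersections. -/
noncomputable def cyclicDegreeSum (M : Matroid α) [M.Finite] : ℕ :=
  ∑ e ∈ M.ground_finite.toFinset, M.cyclicDegree e ^ 2

theorem finite_cyclicFlats (M : Matroid α) [M.Finite] : M.cyclicFlats.Finite :=
  M.ground_finite.finite_subsets.subset fun _ hF => hF.1.subset_ground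

theorem natRk_map_image [M.RankFinite] {f : α → β} (hf : Set.InjOn f M.E) {X : Set α}
    (hX : X ⊆ M.E) : (M.map f hf).natRk (f '' X) = M.natRk X := by
  obtain ⟨I, hI⟩ := M.exists_isBasis X hX
  have h := (map_isBasis_iff f hf hI.indep.subset_ground hX).2 hI
  rw [natRk, natRk, ← h.encard_eq_eRk, ← hI.encard_eq_eRk,
    (hf.mono hI.indep.subset_ground).encard_image]

theorem image_mem_cyclicFlats_map_iff [M.RankFinite] {f : α → β} (hf : Set.InjOn f M.E)
    {F : Set α} (hF : F ⊆ M.E) : f '' F ∈ (M.map f hf).cyclicFlats ↔ F ∈ M.cyclicFlats := by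
  rw [mem_cyclicFlats_iff, mem_cyclicFlats_iff]
  unfold IsCyclicFlatOf
  rw [map_ground, Set.forall_mem_image, Set.forall_mem_image]
  refine and_congr ⟨fun _ => hF, fun _ => Set.image_mono hF⟩ (and_congr ?_ ?_)
  · refine forall₂_congr fun e he => ?_
    rw [hf.mem_image_iff hF he, ← Set.image_insert_eq, natRk_map_image hf hF,
      natRk_map_image hf (Set.insert_subset he hF)]
  · refine forall₂_congr fun e he => ?_
    rw [← Set.image_singleton, ← (hf.mono hF).image_sdiff_subset (by simpa using he),
      natRk_map_image hf hF, natRk_map_image hf (Set.sdiff_subset.trans hF)]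

theorem cyclicDegree_map [M.RankFinite] {f : α → β} (hf : Set.InjOn f M.E) (he : e ∈ M.E) :
    (M.map f hf).cyclicDegree (f e) = M.cyclicDegree e := by
  have h : {G ∈ (M.map f hf).cyclicFlats | f e ∈ G} =
      Set.image f '' {F ∈ M.cyclicFlats | e ∈ F} := by
    ext G
    constructor
    · rintro ⟨hG, heG⟩
      obtain ⟨F, hF, rfl⟩ := Set.subset_image_iff.1 hG.1.subset_ground
      exact ⟨F, ⟨(image_mem_cyclicFlats_map_iff hf hF).1 hG, (hf.mem_image_iff hF he).1 heG⟩, rfl⟩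
    · rintro ⟨F, ⟨hF, heF⟩, rfl⟩
      exact ⟨(image_mem_cyclicFlats_map_iff hf hF.1.subset_ground).2 hF,
        Set.mem_image_of_mem f heF⟩
  rw [cyclicDegree, h, Set.InjOn.ncard_image, cyclicDegree]
  intro F hF G hG hFG
  exact (hf.image_eq_image_iff hF.1.1.subset_ground hG.1.1.subset_ground).1 hFG

theorem IsIsomorphic.cyclicDegreeSum_eq [M.Finite] [N.Finite] (h : M.IsIsomorphic N) :
    N.cyclicDegreeSum = M.cyclicDegreeSum := by
  classical
  obtain ⟨φ, hφ⟩ := h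
  let f : α → α := fun a => if ha : a ∈ M.E then φ ⟨a, ha⟩ else a
  have hfφ : ∀ a : M.E, f a = φ a := fun a => by simp [f]
  have hf : Set.InjOn f M.E := by
    intro a ha b hb hab
    rw [hfφ ⟨a, ha⟩, hfφ ⟨b, hb⟩] at hab
    exact congrArg Subtype.val (φ.injective (Subtype.ext hab))
  have hE : f '' M.E = N.E := by
    ext b
    constructor
    · rintro ⟨a, ha, rfl⟩
      rw [hfφ ⟨a, ha⟩]
      exact (φ _).2
    · intro hb
      refine ⟨φ.symm ⟨b, hb⟩, (φ.symm ⟨b, hb⟩).2, ?_⟩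
      rw [hfφ]
      simp
  have hN : N = M.map f hf := by
    refine ext_indep hE.symm fun I hI => ?_
    obtain ⟨J, hJ, rfl⟩ := Set.subset_image_iff.1 (hE.symm ▸ hI)
    rw [map_image_indep_iff hJ]
    have h1 := hφ {a : M.E | (a : α) ∈ J}
    have h2 : (fun a : M.E => (a : α)) '' {a : M.E | (a : α) ∈ J} = J := by
      ext a
      simpa using fun ha => hJ ha
    have h3 : (fun a : M.E => (φ a : α)) '' {a : M.E | (a : α) ∈ J} = f '' J := by
      nth_rewrite 2 [← h2]
      rw [Set.image_image]
      exact Set.image_congr fun a _ => (hfφ a).symm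
    rw [h2, h3] at h1
    exact h1.symm
  symm
  unfold cyclicDegreeSum
  refine Finset.sum_nbij f (fun a ha => ?_) (fun a ha b hb hab => ?_) (fun b hb => ?_)
    (fun a ha => ?_)
  · rw [Set.Finite.mem_toFinset] at ha ⊢
    exact hE ▸ Set.mem_image_of_mem f ha
  · exact hf (by simpa using ha) (by simpa using hb) hab
  · simpa [hE] using hb
  · rw [Set.Finite.mem_toFinset] at ha
    have h1 : N.cyclicDegree (f a) = (M.map f hf).cyclicDegree (f a) :=
      congrArg (fun K => K.cyclicDegree (f a)) hN
    rw [h1, cyclicDegree_map hf ha]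

/-- If `M` has a cyclic flat that contains `x` and not `y`, and one that contains `y` and not `x`,
then the shift moves cyclic flats from the degree of `y` to the degree of `x`, which
increases the sum of the squares. -/
theorem IsShift.not_isIsomorphic [M.Finite] [N.Finite] (h : IsShift M N x y)
    (hF : F ∈ M.cyclicFlats) (hxF : x ∈ F) (hyF : y ∉ F)
    (hG : G ∈ M.cyclicFlats) (hxG : x ∉ G) (hyG : y ∈ G) : ¬ M.IsIsomorphic N := by
  classical
  intro hiso
  have hsum := hiso.cyclicDegreeSum_eq
  have hdeg : ∀ e, N.cyclicDegree e = {F ∈ M.cyclicFlats | e ∈ shiftSet x y F}.ncard := by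
    intro e
    have : {G ∈ N.cyclicFlats | e ∈ G} =
        shiftSet x y '' {F ∈ M.cyclicFlats | e ∈ shiftSet x y F} := by
      ext G
      constructor
      · rintro ⟨hG, he⟩
        obtain ⟨F, hF, rfl⟩ := h.mem_cyclicFlats_iff_exists.1 hG
        exact ⟨F, ⟨hF, he⟩, rfl⟩
      · rintro ⟨F, ⟨hF, he⟩, rfl⟩
        exact ⟨h.mem_cyclicFlats_iff_exists.2 ⟨F, hF, rfl⟩, he⟩
    rw [cyclicDegree, this, Set.InjOn.ncard_image]
    intro F hF G hG hFG
    exact ((h.shiftSet_subset_shiftSet_iff hF.1 hG.1).1 hFG.subset).antisymm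
      ((h.shiftSet_subset_shiftSet_iff hG.1 hF.1).1 hFG.superset)
  have hfin : ∀ p : Set α → Prop, {F ∈ M.cyclicFlats | p F}.Finite := fun p =>
    M.finite_cyclicFlats.subset (Set.sep_subset _ _)
  have hother : ∀ e, e ≠ x → e ≠ y → N.cyclicDegree e = M.cyclicDegree e := by
    intro e hex hey
    rw [hdeg]
    simp only [mem_shiftSet_iff hex hey]
    rfl
  have hx := hdeg x
  have hy := hdeg y
  simp only [left_mem_shiftSet_iff, right_mem_shiftSet_iff h.ne] at hx hy
  have hadd := Set.ncard_union_add_ncard_inter {F ∈ M.cyclicFlats | x ∈ F}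
    {F ∈ M.cyclicFlats | y ∈ F} (hfin _) (hfin _)
  have hU : {F ∈ M.cyclicFlats | x ∈ F} ∪ {F ∈ M.cyclicFlats | y ∈ F} =
      {F ∈ M.cyclicFlats | x ∈ F ∨ y ∈ F} := by
    ext; simp only [Set.mem_union, Set.mem_sep_iff]; tauto
  have hI : {F ∈ M.cyclicFlats | x ∈ F} ∩ {F ∈ M.cyclicFlats | y ∈ F} =
      {F ∈ M.cyclicFlats | x ∈ F ∧ y ∈ F} := by
    ext; simp only [Set.mem_inter_iff, Set.mem_sep_iff]; tauto
  rw [hU, hI, ← hx, ← hy] at hadd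
  have hltx : M.cyclicDegree x < N.cyclicDegree x := by
    rw [hx]
    refine Set.ncard_lt_ncard ⟨fun K hK => ⟨hK.1, Or.inl hK.2⟩, fun hsub => ?_⟩ (hfin _)
    exact hxG (hsub ⟨hG, Or.inr hyG⟩).2
  have hlty : M.cyclicDegree y < N.cyclicDegree x := by
    rw [hx]
    refine Set.ncard_lt_ncard ⟨fun K hK => ⟨hK.1, Or.inr hK.2⟩, fun hsub => ?_⟩ (hfin _)
    exact hyF (hsub ⟨hF, Or.inl hxF⟩).2
  change _ = M.cyclicDegree x + M.cyclicDegree y at hadd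
  have hxE : x ∈ M.ground_finite.toFinset := by simpa using h.left_mem
  have hyE : y ∈ M.ground_finite.toFinset.erase x := by simpa [h.ne.symm] using h.right_mem
  unfold cyclicDegreeSum at hsum
  have hground : N.ground_finite.toFinset = M.ground_finite.toFinset := by
    ext e; simp [h.ground_eq]
  rw [hground, ← Finset.add_sum_erase _ _ hxE, ← Finset.add_sum_erase _ _ hyE,
    ← Finset.add_sum_erase _ _ hxE, ← Finset.add_sum_erase _ _ hyE,
    Finset.sum_congr rfl fun e he => by
      rw [hother e (by simp at he; tauto) (by simp at he; tauto)]] at hsum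
  nlinarith

end Degree

/-! ### Shift obstructions and bases -/

section Obstruction

variable {M : Matroid α} {x y : α}

theorem IsBase.insert_diff_singleton_iff {B : Set α} {e z : α} (hB : M.IsBase B)
    (he : e ∈ M.E) (heB : e ∉ B) :
    M.IsBase (insert e (B \ {z})) ↔ e ∉ M.closure (B \ {z}) := by
  have hind : M.Indep (B \ {z}) := hB.indep.subset Set.sdiff_subset
  rw [hind.notMem_closure_iff_of_notMem (fun h => heB h.1) he]
  exact ⟨fun h => h.indep, fun h => hB.exchange_isBase_of_indep heB h⟩

theorem mem_ground_of_natRk_insert_ne {e : α} {X : Set α}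
    (h : M.natRk (insert e X) ≠ M.natRk X) : e ∈ M.E := by
  by_contra he
  exact h (by rw [natRk, natRk, eRk_insert_of_notMem_ground X he])

/-- One half of the exchange property of an obstruction: `B` extends a basis `I` of `Z`. -/
theorem exchange_of_mem_closure {B I : Set α} {x y e : α} (hB : M.IsBase B)
    (hI : insert y (insert x I) ⊆ B) (hxI : x ∉ I) (hxy : x ≠ y) (hyI : y ∉ I) (hex : e ≠ x)
    (hecl : e ∈ M.closure (insert x I)) (heI : e ∉ M.closure I) :
    e ∉ B ∧ M.IsBase (insert e (B \ {x})) ∧ ¬ M.IsBase (insert e (B \ {y})) := by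
  have heE : e ∈ M.E := M.closure_subset_ground _ hecl
  have hxB : insert x I ⊆ B := (Set.subset_insert _ _).trans hI
  have hIE : I ⊆ M.E := ((Set.subset_insert _ _).trans hxB).trans hB.subset_ground
  have heB : e ∉ B := by
    intro heB
    have h1 : e ∈ M.closure (insert x I) ∩ B := ⟨hecl, heB⟩
    rw [hB.indep.closure_inter_eq_self_of_subset hxB] at h1
    exact heI (M.subset_closure I hIE (h1.resolve_left hex))
  refine ⟨heB, ?_, ?_⟩
  · rw [hB.insert_diff_singleton_iff heE heB]
    intro h1
    have h2 : M.Indep (insert x I ∪ B \ {x}) :=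
      hB.indep.subset (Set.union_subset hxB Set.sdiff_subset)
    have h3 : e ∈ M.closure (insert x I) ∩ M.closure (B \ {x}) := ⟨hecl, h1⟩
    rw [← h2.closure_inter_eq_inter_closure] at h3
    refine heI (M.closure_subset_closure ?_ h3)
    rintro z ⟨rfl | hz, hz'⟩
    · exact absurd rfl hz'.2
    · exact hz
  · rw [hB.insert_diff_singleton_iff heE heB, not_not]
    exact M.closure_subset_closure
      (Set.subset_sdiff_singleton hxB (by simp [hxy.symm, hyI])) hecl

/-- An obstruction extends to a base `B` that contains `x` and `y`: `e` can be exchanged for `x`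
and not for `y`, and `f` can be exchanged for `y` and not for `x`. -/
theorem IsShiftObstruction.exists_isBase [M.RankFinite] {Z : Set α} {e f : α} (hxy : x ≠ y)
    (hx : x ∈ M.E) (hy : y ∈ M.E) (h : M.IsShiftObstruction x y Z e f) :
    ∃ B, M.IsBase B ∧ x ∈ B ∧ y ∈ B ∧ e ∉ B ∧ f ∉ B ∧
      M.IsBase (insert e (B \ {x})) ∧ ¬ M.IsBase (insert e (B \ {y})) ∧
      M.IsBase (insert f (B \ {y})) ∧ ¬ M.IsBase (insert f (B \ {x})) := by
  obtain ⟨hex, hfy, h1, h2, h3, h4, h5, h6⟩ := h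
  have heE : e ∈ M.E := mem_ground_of_natRk_insert_ne (X := insert y Z) (by omega)
  have hfE : f ∈ M.E := mem_ground_of_natRk_insert_ne (X := insert x Z) (by omega)
  have hxZ : x ∉ M.closure Z := by rw [← natRk_insert_eq_iff M hx]; omega
  have hyZ : y ∉ M.closure Z := by rw [← natRk_insert_eq_iff M hy]; omega
  have hyxZ : y ∉ M.closure (insert x Z) := by
    rw [← natRk_insert_eq_iff M hy]
    have s1 := M.natRk_submod f x (insert y Z)
    have s2 := M.natRk_le_insert y (insert f (insert x Z))
    rw [Set.insert_comm y f, Set.insert_comm y x] at s2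
    rw [Set.insert_comm y x]
    omega
  have hexZ : e ∈ M.closure (insert x Z) := by rw [← natRk_insert_eq_iff M heE]; omega
  have hfyZ : f ∈ M.closure (insert y Z) := by rw [← natRk_insert_eq_iff M hfE]; omega
  have heZ : e ∉ M.closure Z := fun hh => by
    have hh' := M.closure_subset_closure (Set.subset_insert y Z) hh
    rw [← natRk_insert_eq_iff M heE] at hh'
    omega
  have hfZ : f ∉ M.closure Z := fun hh => by
    have hh' := M.closure_subset_closure (Set.subset_insert x Z) hh
    rw [← natRk_insert_eq_iff M hfE] at hh'
    omega
  obtain ⟨I, hI⟩ := M.exists_isBasis' Z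
  have hcl : M.closure I = M.closure Z := hI.closure_eq_closure
  have hins : ∀ a, M.closure (insert a I) = M.closure (insert a Z) := fun a => by
    rw [← M.closure_insert_closure_eq_closure_insert, hcl,
      M.closure_insert_closure_eq_closure_insert]
  rw [← hcl] at hxZ hyZ heZ hfZ
  rw [← hins] at hyxZ hexZ hfyZ
  have hIE := hI.indep.subset_ground
  have hxI : x ∉ I := fun hh => hxZ (M.subset_closure I hIE hh)
  have hyI : y ∉ I := fun hh => hyZ (M.subset_closure I hIE hh)
  have hJ : M.Indep (insert y (insert x I)) := by
    have h7 : M.Indep (insert x I) := (hI.indep.notMem_closure_iff_of_notMem hxI hx).1 hxZ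
    exact (h7.notMem_closure_iff_of_notMem (by simp [hxy.symm, hyI]) hy).1 hyxZ
  obtain ⟨B, hB, hJB⟩ := hJ.exists_isBase_superset
  obtain ⟨heB, he1, he2⟩ := exchange_of_mem_closure hB hJB hxI hxy hyI hex hexZ heZ
  obtain ⟨hfB, hf1, hf2⟩ := exchange_of_mem_closure hB (Set.insert_comm x y I ▸ hJB) hyI hxy.symm
    hxI hfy hfyZ hfZ
  exact ⟨B, hB, hJB (by simp), hJB (by simp), heB, hfB, he1, he2, hf1, hf2⟩

end Obstruction

/-- If no base `B` that contains `x` and `y` has elements `e` and `f` outside of it such that `e` can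
be exchanged for `x` and not for `y`, and `f` for `y` and not for `x`, then the shift of `M`
from `x` to `y` is a matroid. -/
theorem exists_isShift {M : Matroid α} [M.Finite] {x y : α} (hxy : x ≠ y)
    (hx : x ∈ M.E) (hy : y ∈ M.E)
    (h : ∀ B e f, M.IsBase B → x ∈ B → y ∈ B → e ∉ B → f ∉ B →
      M.IsBase (insert e (B \ {x})) → ¬ M.IsBase (insert e (B \ {y})) →
      M.IsBase (insert f (B \ {y})) → M.IsBase (insert f (B \ {x}))) :
    ∃ N : Matroid α, N.Finite ∧ IsShift M N x y := by
  have hρ : IsRankFunction (M.shiftRk x y) := isRankFunction_shiftRk hxy fun Z e f hobs => by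
    obtain ⟨B, hB, hxB, hyB, heB, hfB, h1, h2, h3, h4⟩ := hobs.exists_isBase hxy hx hy
    exact h4 (h B e f hB hxB hyB heB hfB h1 h2 h3)
  exact ⟨hρ.matroid M.ground_finite, hρ.matroid_finite _, hxy, hx, hy, rfl,
    fun X hX => hρ.natRk_matroid _ hX⟩

end Matroid

/-! ### Lattice paths as height functions -/

/-- The number of elements of `S` among `1, …, k`. -/
noncomputable def initialCount (S : Set ℕ) (k : ℕ) : ℕ := (S ∩ Set.Icc 1 k).ncard

theorem initialCount_zero (S : Set ℕ) : initialCount S 0 = 0 := by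
  simp [initialCount]

theorem initialCount_mono (S : Set ℕ) {j k : ℕ} (h : j ≤ k) :
    initialCount S j ≤ initialCount S k :=
  Set.ncard_le_ncard (Set.inter_subset_inter_right _ (Set.Icc_subset_Icc_right h))
    ((Set.finite_Icc 1 k).inter_of_right _)

theorem initialCount_succ_of_mem {S : Set ℕ} {k : ℕ} (h : k + 1 ∈ S) :
    initialCount S (k + 1) = initialCount S k + 1 := by
  have h1 : S ∩ Set.Icc 1 (k + 1) = insert (k + 1) (S ∩ Set.Icc 1 k) := by
    ext z
    simp only [Set.mem_inter_iff, Set.mem_Icc, Set.mem_insert_iff]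
    constructor
    · rintro ⟨hz, h1, h2⟩
      by_cases hzk : z = k + 1
      · exact Or.inl hzk
      · exact Or.inr ⟨hz, h1, by omega⟩
    · rintro (rfl | ⟨hz, h1, h2⟩)
      · exact ⟨h, by omega, le_rfl⟩
      · exact ⟨hz, h1, by omega⟩
  rw [initialCount, h1, Set.ncard_insert_of_notMem (by simp)
    ((Set.finite_Icc 1 k).inter_of_right _), initialCount]

theorem initialCount_succ_of_notMem {S : Set ℕ} {k : ℕ} (h : k + 1 ∉ S) :
    initialCount S (k + 1) = initialCount S k := by
  have h1 : S ∩ Set.Icc 1 (k + 1) = S ∩ Set.Icc 1 k := by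
    ext z
    simp only [Set.mem_inter_iff, Set.mem_Icc]
    refine and_congr_right fun hz => ⟨fun hh => ⟨hh.1, ?_⟩, fun hh => ⟨hh.1, by omega⟩⟩
    have : z ≠ k + 1 := by rintro rfl; exact h hz
    omega
  rw [initialCount, h1, initialCount]

theorem initialCount_succ_eq_or (S : Set ℕ) (k : ℕ) :
    initialCount S (k + 1) = initialCount S k ∨ initialCount S (k + 1) = initialCount S k + 1 := by
  by_cases h : k + 1 ∈ S
  · exact Or.inr (initialCount_succ_of_mem h)
  · exact Or.inl (initialCount_succ_of_notMem h)

theorem initialCount_le_add (S : Set ℕ) (j k : ℕ) :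
    initialCount S j ≤ initialCount S k + (j - k) := by
  induction j with
  | zero => simp [initialCount_zero]
  | succ j ih =>
    rcases le_or_gt (j + 1) k with h | h
    · exact (initialCount_mono S h).trans (Nat.le_add_right _ _)
    · have := initialCount_succ_eq_or S j
      omega

theorem initialCount_eq_ncard {S : Set ℕ} {n k : ℕ} (hS : S ⊆ Set.Icc 1 n) (hk : n ≤ k) :
    initialCount S k = S.ncard := by
  rw [initialCount, Set.inter_eq_self_of_subset_left (hS.trans (Set.Icc_subset_Icc_right hk))]

theorem initialCount_add_ncard_Icc {S : Set ℕ} {n k : ℕ} (hS : S ⊆ Set.Icc 1 n) :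
    initialCount S k + (S ∩ Set.Icc (k + 1) n).ncard = S.ncard := by
  rw [initialCount, ← Set.ncard_union_eq]
  · congr 1
    ext z
    simp only [Set.mem_union, Set.mem_inter_iff, Set.mem_Icc]
    refine ⟨fun hz => hz.elim And.left And.left, fun hz => ?_⟩
    have := hS hz
    simp only [Set.mem_Icc] at this
    by_cases h : z ≤ k
    · exact Or.inl ⟨hz, this.1, h⟩
    · exact Or.inr ⟨hz, by omega, this.2⟩
  · rw [Set.disjoint_left]
    rintro z ⟨-, hz⟩ ⟨-, hz'⟩
    simp only [Set.mem_Icc] at hz hz'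
    omega

theorem initialCount_exchange {S : Set ℕ} {e z : ℕ} (hz : z ∈ S) (he : e ∉ S) (hz1 : 1 ≤ z)
    (he1 : 1 ≤ e) (k : ℕ) :
    initialCount (insert e (S \ {z})) k + (if z ≤ k then 1 else 0) =
      initialCount S k + (if e ≤ k then 1 else 0) := by
  have hez : e ≠ z := by rintro rfl; exact he hz
  induction k with
  | zero => simp [initialCount_zero, show ¬ z ≤ 0 by omega, show ¬ e ≤ 0 by omega]
  | succ k ih =>
    rcases eq_or_ne (k + 1) e with h | hke
    · rw [initialCount_succ_of_mem (by simp [h]), initialCount_succ_of_notMem (h ▸ he)]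
      split_ifs at ih ⊢ <;> omega
    rcases eq_or_ne (k + 1) z with h | hkz
    · rw [initialCount_succ_of_mem (S := S) (h ▸ hz),
        initialCount_succ_of_notMem (by simp [h, hez.symm])]
      split_ifs at ih ⊢ <;> omega
    by_cases hk : k + 1 ∈ S
    · rw [initialCount_succ_of_mem hk, initialCount_succ_of_mem (by simp [hk, hkz])]
      split_ifs at ih ⊢ <;> omega
    · rw [initialCount_succ_of_notMem hk, initialCount_succ_of_notMem (by simp [hk, hke])]
      split_ifs at ih ⊢ <;> omega

/-- The set of positions at which the function `h` increases; for the height function of a lattice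
path, this is the set of its north steps. -/
def stepSet (h : ℕ → ℕ) : Set ℕ := {k | 1 ≤ k ∧ h k = h (k - 1) + 1}

theorem succ_mem_stepSet {h : ℕ → ℕ} {k : ℕ} : k + 1 ∈ stepSet h ↔ h (k + 1) = h k + 1 := by
  simp [stepSet]

theorem initialCount_stepSet {h : ℕ → ℕ} (h0 : h 0 = 0)
    (hs : ∀ k, h (k + 1) = h k ∨ h (k + 1) = h k + 1) (k : ℕ) :
    initialCount (stepSet h) k = h k := by
  induction k with
  | zero => rw [initialCount_zero, h0]
  | succ k ih =>
    rcases hs k with hk | hk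
    · rw [initialCount_succ_of_notMem (by rw [succ_mem_stepSet]; omega), ih, hk]
    · rw [initialCount_succ_of_mem (by rw [succ_mem_stepSet]; omega), ih, hk]

open scoped Classical in
theorem count_succ_eq_initialCount {S : Set ℕ} {n : ℕ} (hS : S ⊆ Set.Icc 1 n) (k : ℕ) :
    Nat.count (· ∈ S) (k + 1) = initialCount S k := by
  rw [Nat.count_eq_card_filter_range, initialCount, ← Set.ncard_coe_finset]
  congr 1
  ext z
  simp only [Finset.coe_filter, Finset.mem_range, Set.mem_ofPred_eq, Set.mem_inter_iff, Set.mem_Icc]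
  exact ⟨fun hz => ⟨hz.2, (hS hz.2).1, by omega⟩, fun hz => ⟨by omega, hz.1⟩⟩

theorem nth_le_of_lt_initialCount {S : Set ℕ} {n i k : ℕ} (hS : S ⊆ Set.Icc 1 n)
    (h : i < initialCount S k) : Nat.nth (· ∈ S) i ≤ k := by
  classical
  rw [← count_succ_eq_initialCount hS] at h
  exact Nat.lt_succ_iff.1 (Nat.nth_lt_of_lt_count h)

theorem lt_initialCount_of_nth_le {S : Set ℕ} {n i k : ℕ} (hS : S ⊆ Set.Icc 1 n)
    (hi : i < S.ncard) (h : Nat.nth (· ∈ S) i ≤ k) : i < initialCount S k := by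
  classical
  have h1 : Nat.count (· ∈ S) (Nat.nth (· ∈ S) i + 1) = i + 1 :=
    Nat.count_nth_succ fun hf => by rwa [← Set.ncard_eq_toFinset_card S hf]
  rw [count_succ_eq_initialCount hS] at h1
  have h2 := initialCount_mono S h
  omega

namespace LatticePath

theorem height_zero (P : LatticePath) : P.height 0 = 0 := by
  simp [height]

theorem isNorthStep_succ_iff (P : LatticePath) (k : ℕ) :
    P.IsNorthStep (k + 1) ↔ P.height (k + 1) = P.height k + 1 := by
  simp only [IsNorthStep, height, List.take_add_one, Nat.add_sub_cancel, List.count_append]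
  rcases hP : P[k]? with _ | (_ | _) <;> simp

theorem height_succ_eq_or (P : LatticePath) (k : ℕ) :
    P.height (k + 1) = P.height k ∨ P.height (k + 1) = P.height k + 1 := by
  simp only [height, List.take_add_one, List.count_append]
  rcases P[k]? with _ | (_ | _) <;> simp

theorem height_mono (P : LatticePath) : Monotone P.height :=
  monotone_nat_of_le_succ fun k => by have := P.height_succ_eq_or k; omega

theorem setOf_isNorthStep (P : LatticePath) : {k | P.IsNorthStep k} = stepSet P.height := by
  ext k
  cases k with
  | zero => simp [IsNorthStep, stepSet]
  | succ k => exact (P.isNorthStep_succ_iff k).trans succ_mem_stepSet.symm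

theorem northPosition_eq_nth (P : LatticePath) (i : ℕ) :
    P.northPosition i = Nat.nth (· ∈ stepSet P.height) i := by
  rw [← P.setOf_isNorthStep]
  rfl

theorem initialCount_stepSet_height (P : LatticePath) (k : ℕ) :
    initialCount (stepSet P.height) k = P.height k :=
  initialCount_stepSet P.height_zero P.height_succ_eq_or k

theorem height_le_add (P : LatticePath) (j k : ℕ) : P.height j ≤ P.height k + (j - k) := by
  simpa only [initialCount_stepSet_height] using initialCount_le_add (stepSet P.height) j k

theorem length_eq (P : LatticePath) :
    P.length = P.count LatticeStep.east + P.count LatticeStep.north := by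
  induction P with
  | nil => rfl
  | cons s P ih => cases s <;> simp [ih] <;> omega

end LatticePath

namespace LatticePathPair

variable {m r : ℕ} (D : LatticePathPair m r)

theorem height_P_of_le {k : ℕ} (hk : m + r ≤ k) : D.P.height k = r := by
  rw [LatticePath.height, List.take_of_length_le, D.count_north_P]
  rwa [D.P.length_eq, D.count_east_P, D.count_north_P]

theorem height_Q_of_le {k : ℕ} (hk : m + r ≤ k) : D.Q.height k = r := by
  rw [LatticePath.height, List.take_of_length_le, D.count_north_Q]
  rwa [D.Q.length_eq, D.count_east_Q, D.count_north_Q]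

/-- A set of positions that describes a lattice path between `P` and `Q`. -/
structure IsBetween (B : Set ℕ) : Prop where
  subset_Icc : B ⊆ Set.Icc 1 (m + r)
  le_initialCount : ∀ k, D.P.height k ≤ initialCount B k
  initialCount_le : ∀ k, initialCount B k ≤ D.Q.height k

variable {D}

theorem IsBetween.ncard_eq {B : Set ℕ} (hB : D.IsBetween B) : B.ncard = r := by
  rw [← initialCount_eq_ncard hB.subset_Icc le_rfl]
  have h1 := hB.le_initialCount (m + r)
  have h2 := hB.initialCount_le (m + r)
  rw [D.height_P_of_le le_rfl] at h1
  rw [D.height_Q_of_le le_rfl] at h2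
  omega

theorem isBetween_stepSet {h : ℕ → ℕ} (hs : ∀ k, h (k + 1) = h k ∨ h (k + 1) = h k + 1)
    (hP : ∀ k, D.P.height k ≤ h k) (hQ : ∀ k, h k ≤ D.Q.height k) :
    D.IsBetween (stepSet h) := by
  have h0 : h 0 = 0 := by
    have := hQ 0
    rw [D.Q.height_zero] at this
    omega
  refine ⟨?_, fun k => by rw [initialCount_stepSet h0 hs]; exact hP k,
    fun k => by rw [initialCount_stepSet h0 hs]; exact hQ k⟩
  rintro k ⟨hk1, hk⟩
  refine ⟨hk1, ?_⟩
  by_contra hkn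
  have h1 := hP (k - 1)
  have h2 := hQ k
  rw [D.height_P_of_le (by omega)] at h1
  rw [D.height_Q_of_le (by omega)] at h2
  omega

theorem isBetween_stepSet_Q : D.IsBetween (stepSet D.Q.height) :=
  isBetween_stepSet D.Q.height_succ_eq_or D.height_le fun _ => le_rfl

theorem isBetween_stepSet_P : D.IsBetween (stepSet D.P.height) :=
  isBetween_stepSet D.P.height_succ_eq_or (fun _ => le_rfl) D.height_le

end LatticePathPair

namespace Matroid

/-! ### Bases and ranks in a lattice path matroid -/

variable {m r : ℕ} {D : LatticePathPair m r}

instance : (latticePathMatroid D).Finite := ⟨Set.finite_Icc 1 (m + r)⟩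

theorem latticePathMatroid_indep_iff {I : Set ℕ} : (latticePathMatroid D).Indep I ↔
    I ⊆ Set.Icc 1 (m + r) ∧ IsPartialTransversal D.interval I := Iff.rfl

theorem indep_of_isBetween {B : Set ℕ} (hB : D.IsBetween B) :
    (latticePathMatroid D).Indep B := by
  classical
  refine latticePathMatroid_indep_iff.2 ⟨hB.subset_Icc, ?_⟩
  have hBfin : B.Finite := (Set.finite_Icc _ _).subset hB.subset_Icc
  have hlt : ∀ x : B, Nat.count (· ∈ B) x < r := by
    intro x
    have := Nat.count_lt_card (p := (· ∈ B)) hBfin x.2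
    rwa [← hB.ncard_eq, Set.ncard_eq_toFinset_card _ hBfin]
  refine ⟨fun x => ⟨Nat.count (· ∈ B) x, hlt x⟩, fun x y hxy => ?_, fun x => ?_⟩
  · exact Subtype.ext (Nat.count_injective x.2 y.2 (congrArg Fin.val hxy))
  · have hx : Nat.nth (· ∈ B) (Nat.count (· ∈ B) x) = x := Nat.nth_count (p := (· ∈ B)) x.2
    constructor
    · rw [LatticePath.northPosition_eq_nth]
      refine nth_le_of_lt_initialCount LatticePathPair.isBetween_stepSet_Q.subset_Icc ?_
      rw [LatticePath.initialCount_stepSet_height]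
      exact (lt_initialCount_of_nth_le hB.subset_Icc (hB.ncard_eq ▸ hlt x) hx.le).trans_le
        (hB.initialCount_le x)
    · rw [LatticePath.northPosition_eq_nth]
      refine hx.symm.trans_le (nth_le_of_lt_initialCount hB.subset_Icc
        (lt_of_lt_of_le ?_ (hB.le_initialCount _)))
      rw [← LatticePath.initialCount_stepSet_height]
      refine lt_initialCount_of_nth_le LatticePathPair.isBetween_stepSet_P.subset_Icc ?_ le_rfl
      rw [LatticePathPair.isBetween_stepSet_P.ncard_eq]
      exact hlt x

theorem ncard_le_of_indep {I : Set ℕ} (hI : (latticePathMatroid D).Indep I) : I.ncard ≤ r := by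
  obtain ⟨-, f, hf, -⟩ := latticePathMatroid_indep_iff.1 hI
  have := Nat.card_le_card_of_injective f hf
  simpa using this

/-- The bases of a lattice path matroid are the sets of north steps of the lattice paths between
`P` and `Q`. -/
theorem latticePathMatroid_isBase_iff {B : Set ℕ} :
    (latticePathMatroid D).IsBase B ↔ D.IsBetween B := by
  classical
  have hback : ∀ {B}, D.IsBetween B → (latticePathMatroid D).IsBase B := by
    intro B hB
    obtain ⟨B', hB', hBB'⟩ := (indep_of_isBetween hB).exists_isBase_superset
    have h1 := ncard_le_of_indep hB'.indep
    rw [← hB.ncard_eq] at h1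
    rwa [Set.eq_of_subset_of_ncard_le hBB' h1
      ((latticePathMatroid D).ground_finite.subset hB'.subset_ground)]
  refine ⟨fun hB => ?_, hback⟩
  have hBr : B.ncard = r :=
    (hB.ncard_eq_ncard_of_isBase (hback LatticePathPair.isBetween_stepSet_Q)).trans
      LatticePathPair.isBetween_stepSet_Q.ncard_eq
  obtain ⟨hBE, f, hf, hfB⟩ := latticePathMatroid_indep_iff.1 hB.indep
  -- A part of `B` that the matching `f` sends into `T` has at most `#T` elements.
  have hcard : ∀ (S : Set ℕ) (T : Finset ℕ), S ⊆ B → (∀ x : B, (x : ℕ) ∈ S → (f x : ℕ) ∈ T) →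
      S.ncard ≤ T.card := by
    intro S T hSB hST
    rw [← Set.ncard_coe_finset]
    refine Set.ncard_le_ncard_of_injOn (fun x => if hx : x ∈ B then (f ⟨x, hx⟩ : ℕ) else 0)
      (fun x hx => ?_) (fun x hx y hy hxy => ?_) T.finite_toSet
    · simpa [hSB hx] using hST ⟨x, hSB hx⟩ hx
    · simp only [hSB hx, hSB hy, dite_true] at hxy
      exact congrArg Subtype.val (hf (Fin.ext hxy))
  refine ⟨hBE, fun k => ?_, fun k => ?_⟩
  · have h1 := initialCount_add_ncard_Icc (k := k) hBE
    have h2 := hcard (B ∩ Set.Icc (k + 1) (m + r)) (Finset.Ico (D.P.height k) r)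
      Set.inter_subset_left fun x hx => by
        rw [Finset.mem_Ico]
        refine ⟨?_, (f x).2⟩
        by_contra hlt
        have h3 : D.P.northPosition (f x) ≤ k := by
          rw [LatticePath.northPosition_eq_nth]
          refine nth_le_of_lt_initialCount LatticePathPair.isBetween_stepSet_P.subset_Icc ?_
          rw [LatticePath.initialCount_stepSet_height]
          have := (f x).2
          omega
        have h4 := (hfB x).2
        have h5 := hx.2.1
        omega
    rw [Nat.card_Ico] at h2
    have h3 := D.P.height_mono (le_max_right (m + r) k)
    rw [D.height_P_of_le (le_max_left (m + r) k)] at h3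
    omega
  · have h2 := hcard (B ∩ Set.Icc 1 k) (Finset.range (D.Q.height k))
      Set.inter_subset_left fun x hx => by
        rw [Finset.mem_range]
        rw [← LatticePath.initialCount_stepSet_height]
        refine lt_initialCount_of_nth_le LatticePathPair.isBetween_stepSet_Q.subset_Icc ?_ ?_
        · rw [LatticePathPair.isBetween_stepSet_Q.ncard_eq]
          exact (f x).2
        · rw [← LatticePath.northPosition_eq_nth]
          exact (hfB x).1.trans hx.2.2
    rwa [Finset.card_range] at h2

theorem ncard_inter_le_natRk {B : Set ℕ} (hB : D.IsBetween B) (X : Set ℕ) :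
    (B ∩ X).ncard ≤ (latticePathMatroid D).natRk X := by
  have hI := (latticePathMatroid_isBase_iff.2 hB).indep.subset (Set.inter_subset_left (t := X))
  rw [← ((latticePathMatroid D).indep_iff_natRk_eq_ncard hI.subset_ground).1 hI]
  exact natRk_mono _ Set.inter_subset_right

theorem exists_natRk_eq_ncard_inter (D : LatticePathPair m r) (X : Set ℕ) :
    ∃ B, D.IsBetween B ∧ (latticePathMatroid D).natRk X = (B ∩ X).ncard := by
  obtain ⟨I, hI⟩ := (latticePathMatroid D).exists_isBasis' X
  obtain ⟨B, hB, hIB⟩ := hI.indep.exists_isBase_superset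
  have hB' := latticePathMatroid_isBase_iff.1 hB
  refine ⟨B, hB', (ncard_inter_le_natRk hB' X).antisymm' ?_⟩
  rw [natRk, ← hI.encard_eq_eRk, ← Set.ncard_def]
  exact Set.ncard_le_ncard (Set.subset_inter hIB hI.subset)
    (((Set.finite_Icc _ _).subset hB'.subset_Icc).inter_of_left _)

theorem natRk_Icc_one (D : LatticePathPair m r) (k : ℕ) :
    (latticePathMatroid D).natRk (Set.Icc 1 k) = D.Q.height k := by
  obtain ⟨B, hB, h⟩ := exists_natRk_eq_ncard_inter D (Set.Icc 1 k)
  have h1 := ncard_inter_le_natRk (D := D) LatticePathPair.isBetween_stepSet_Q (Set.Icc 1 k)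
  have h2 := hB.initialCount_le k
  have h3 := D.Q.initialCount_stepSet_height k
  unfold initialCount at h2 h3
  omega

theorem natRk_Icc_top (D : LatticePathPair m r) (k : ℕ) :
    (latticePathMatroid D).natRk (Set.Icc (k + 1) (m + r)) + D.P.height k = r := by
  obtain ⟨B, hB, h⟩ := exists_natRk_eq_ncard_inter D (Set.Icc (k + 1) (m + r))
  have hN := LatticePathPair.isBetween_stepSet_P (D := D)
  have h1 := ncard_inter_le_natRk hN (Set.Icc (k + 1) (m + r))
  have h2 := hB.le_initialCount k
  have h3 := D.P.initialCount_stepSet_height k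
  have h4 := initialCount_add_ncard_Icc (k := k) hB.subset_Icc
  have h5 := initialCount_add_ncard_Icc (k := k) hN.subset_Icc
  rw [hB.ncard_eq] at h4
  rw [hN.ncard_eq] at h5
  omega

/-- In a connected lattice path matroid, the two bounding paths meet only at their ends: if they met
after step `k`, then every base would meet `{1, …, k}` in the same number of elements, and no
circuit could contain both `1` and `m + r`. -/
theorem height_lt_of_isConnected (hconn : (latticePathMatroid D).IsConnected) {k : ℕ}
    (hk : 0 < k) (hkn : k < m + r) : D.P.height k < D.Q.height k := by
  refine (D.height_le k).lt_of_ne fun heq => ?_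
  obtain ⟨C, hC, h1C, hnC⟩ := hconn 1 ⟨le_rfl, by omega⟩ (m + r) ⟨by omega, le_rfl⟩ (by omega)
  have hind : ∀ e ∈ C, ∃ B, D.IsBetween B ∧ C \ {e} ⊆ B := by
    intro e he
    obtain ⟨B, hB, hCB⟩ := (hC.sdiff_singleton_indep he).exists_isBase_superset
    exact ⟨B, latticePathMatroid_isBase_iff.1 hB, hCB⟩
  obtain ⟨B₁, hB₁, hC₁⟩ := hind _ hnC
  obtain ⟨B₂, hB₂, hC₂⟩ := hind _ h1C
  -- The path that follows `B₁` up to the common point and `B₂` afterwards contains `C`.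
  let h : ℕ → ℕ := fun j => if j ≤ k then initialCount B₁ j else initialCount B₂ j
  have hk₁ : initialCount B₁ k = D.P.height k :=
    ((hB₁.initialCount_le k).trans_eq heq.symm).antisymm (hB₁.le_initialCount k)
  have hk₂ : initialCount B₂ k = D.P.height k :=
    ((hB₂.initialCount_le k).trans_eq heq.symm).antisymm (hB₂.le_initialCount k)
  have hlow : ∀ j ≤ k, h j = initialCount B₁ j := fun j hj => by simp [h, hj]
  have hhigh : ∀ j, k ≤ j → h j = initialCount B₂ j := fun j hj => by
    rcases hj.eq_or_lt with rfl | hj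
    · simp [h, hk₁, hk₂]
    · simp [h, show ¬ j ≤ k by omega]
  have hB : D.IsBetween (stepSet h) := by
    refine LatticePathPair.isBetween_stepSet (fun j => ?_) (fun j => ?_) (fun j => ?_)
    · by_cases hj : j + 1 ≤ k
      · rw [hlow _ hj, hlow j (by omega)]
        exact initialCount_succ_eq_or _ _
      · rw [hhigh _ (by omega), hhigh j (by omega)]
        exact initialCount_succ_eq_or _ _
    · rcases le_total j k with hj | hj
      · rw [hlow j hj]; exact hB₁.le_initialCount j
      · rw [hhigh j hj]; exact hB₂.le_initialCount j
    · rcases le_total j k with hj | hj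
      · rw [hlow j hj]; exact hB₁.initialCount_le j
      · rw [hhigh j hj]; exact hB₂.initialCount_le j
  refine hC.dep.not_indep ((latticePathMatroid_isBase_iff.2 hB).indep.subset fun z hz => ?_)
  obtain ⟨hz1, hzn⟩ := hC.subset_ground hz
  obtain ⟨j, rfl⟩ : ∃ j, z = j + 1 := ⟨z - 1, by omega⟩
  rw [succ_mem_stepSet]
  by_cases hj : j + 1 ≤ k
  · rw [hlow _ hj, hlow j (by omega)]
    exact initialCount_succ_of_mem (hC₁ ⟨hz, by simp only [Set.mem_singleton_iff]; omega⟩)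
  · rw [hhigh _ (by omega), hhigh j (by omega)]
    exact initialCount_succ_of_mem (hC₂ ⟨hz, by simp only [Set.mem_singleton_iff]; omega⟩)

/-! ### Initial and final connected flats -/

theorem IsProperNontrivialConnectedFlat.mem_cyclicFlats {α : Type*} {M : Matroid α} [M.Finite]
    {X : Set α} (hX : M.IsProperNontrivialConnectedFlat X) : X ∈ M.cyclicFlats := by
  obtain ⟨hflat, hconn, hrk, -⟩ := hX
  rw [mem_cyclicFlats_iff]
  have hXE := hflat.subset_ground
  refine ⟨hXE, fun e he heX h => heX ?_, fun e he => ?_⟩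
  · rw [natRk_insert_eq_iff M he, hflat.closure] at h
    exact h
  · have hins : insert e (X \ {e}) = X := by
      rw [Set.insert_sdiff_singleton, Set.insert_eq_of_mem he]
    by_cases hsub : X ⊆ {e}
    · obtain rfl : X = {e} := hsub.antisymm (Set.singleton_subset_iff.2 he)
      have h1 := M.natRk_insert_le e ∅
      rw [natRk_empty] at h1
      have h2 : M.natRk {e} ≠ 1 := by
        intro h
        rw [← coe_natRk, h] at hrk
        simp at hrk
      simp only [Set.sdiff_self, natRk_empty, insert_empty_eq] at h1 ⊢
      omega
    · obtain ⟨z, hz, hze⟩ := Set.not_subset.1 hsub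
      obtain ⟨C, hC, heC, -⟩ := hconn e he z hz (Ne.symm hze)
      rw [restrict_isCircuit_iff hXE] at hC
      have h1 := M.closure_subset_closure (Set.sdiff_subset_sdiff_left hC.2)
        (hC.1.mem_closure_sdiff_singleton_of_mem heC)
      rw [← natRk_insert_eq_iff M (hXE he), hins] at h1
      exact h1.symm

/-- Step `a` of `Q` is an east step and step `a + 1` is a north step. In a connected lattice path
matroid, this means that the initial interval `[a]` is a proper nonempty cyclic flat. -/
def IsUpperCorner (D : LatticePathPair m r) (a : ℕ) : Prop :=
  1 ≤ a ∧ a < m + r ∧ D.Q.height a = D.Q.height (a - 1) ∧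
    D.Q.height (a + 1) = D.Q.height a + 1

/-- Step `c` of `P` is a north step and step `c + 1` is an east step. In a connected lattice path
matroid, this means that the final interval `[c + 1, m + r]` is a proper nonempty cyclic flat. -/
def IsLowerCorner (D : LatticePathPair m r) (c : ℕ) : Prop :=
  1 ≤ c ∧ c < m + r ∧ D.P.height c = D.P.height (c - 1) + 1 ∧
    D.P.height (c + 1) = D.P.height c

theorem IsInitialConnectedFlat.isUpperCorner {a : ℕ}
    (h : (latticePathMatroid D).IsInitialConnectedFlat (Set.Icc 1 a)) : IsUpperCorner D a := by
  obtain ⟨hX, -⟩ := h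
  have hne : 1 ≤ a := by
    by_contra h0
    refine hX.2.2.1 ?_
    rw [Set.Icc_eq_empty (by omega)]
    simp
  have hle : a ≤ m + r := (hX.1.subset_ground (show a ∈ Set.Icc 1 a from ⟨hne, le_rfl⟩)).2
  have hlt : a < m + r := hle.lt_of_ne fun h => hX.2.2.2 (by rw [h]; rfl)
  obtain ⟨-, hflat, hcyc⟩ := mem_cyclicFlats_iff.1 hX.mem_cyclicFlats
  refine ⟨hne, hlt, ?_, ?_⟩
  · have h1 := hcyc a ⟨hne, le_rfl⟩
    have h2 : Set.Icc 1 a \ {a} = Set.Icc 1 (a - 1) := by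
      ext z; simp only [Set.mem_sdiff, Set.mem_Icc, Set.mem_singleton_iff]; omega
    rw [h2, natRk_Icc_one, natRk_Icc_one] at h1
    exact h1.symm
  · have h1 := hflat (a + 1) ⟨by omega, by omega⟩ (by simp)
    have h2 : insert (a + 1) (Set.Icc 1 a) = Set.Icc 1 (a + 1) := by
      ext z; simp only [Set.mem_insert_iff, Set.mem_Icc]; omega
    rw [h2, natRk_Icc_one, natRk_Icc_one] at h1
    exact (D.Q.height_succ_eq_or a).resolve_left h1

theorem IsFinalConnectedFlat.exists_isLowerCorner {b : ℕ}
    (h : (latticePathMatroid D).IsFinalConnectedFlat (m + r) (Set.Icc b (m + r))) :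
    ∃ c, b = c + 1 ∧ IsLowerCorner D c := by
  obtain ⟨hX, -⟩ := h
  have hne : b ≤ m + r := by
    by_contra h0
    refine hX.2.2.1 ?_
    rw [Set.Icc_eq_empty (by omega)]
    simp
  have hb1 : 1 ≤ b := (hX.1.subset_ground (show b ∈ Set.Icc b (m + r) from ⟨le_rfl, hne⟩)).1
  have hb : b ≠ 1 := fun h => hX.2.2.2 (by rw [h]; rfl)
  obtain ⟨-, hflat, hcyc⟩ := mem_cyclicFlats_iff.1 hX.mem_cyclicFlats
  obtain ⟨c, rfl⟩ : ∃ c, b = c + 1 := ⟨b - 1, by omega⟩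
  have h0 := natRk_Icc_top D c
  refine ⟨c, rfl, by omega, by omega, ?_, ?_⟩
  · have h1 := hflat c ⟨by omega, by omega⟩ (by simp)
    have h2 : insert c (Set.Icc (c + 1) (m + r)) = Set.Icc (c - 1 + 1) (m + r) := by
      ext z; simp only [Set.mem_insert_iff, Set.mem_Icc]; omega
    have h3 := natRk_Icc_top D (c - 1)
    have h4 := D.P.height_succ_eq_or (c - 1)
    rw [h2] at h1
    rw [show c - 1 + 1 = c by omega] at h1 h3 h4
    omega
  · have h1 := hcyc (c + 1) ⟨le_rfl, hne⟩
    have h2 : Set.Icc (c + 1) (m + r) \ {c + 1} = Set.Icc (c + 1 + 1) (m + r) := by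
      ext z; simp only [Set.mem_sdiff, Set.mem_Icc, Set.mem_singleton_iff]; omega
    have h3 := natRk_Icc_top D (c + 1)
    rw [h2] at h1
    omega

/-- Exchanging `z` for `e` lowers the path on `[z, e)` or raises it on `[e, z)`. -/
theorem isBetween_exchange {B : Set ℕ} (hB : D.IsBetween B) {e z : ℕ} (hz : z ∈ B) (he : e ∉ B)
    (hen : e ∈ Set.Icc 1 (m + r))
    (hP : ∀ k, z ≤ k → k < e → D.P.height k < initialCount B k)
    (hQ : ∀ k, e ≤ k → k < z → initialCount B k < D.Q.height k) :
    D.IsBetween (insert e (B \ {z})) := by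
  have hex := initialCount_exchange hz he (hB.subset_Icc hz).1 hen.1
  refine ⟨Set.insert_subset hen (Set.sdiff_subset.trans hB.subset_Icc), fun k => ?_, fun k => ?_⟩
  · have h1 := hex k
    have h2 := hB.le_initialCount k
    have h3 := hP k
    split_ifs at h1 <;> omega
  · have h1 := hex k
    have h2 := hB.initialCount_le k
    have h3 := hQ k
    split_ifs at h1 <;> omega

theorem IsUpperCorner.mem_cyclicFlats (hconn : (latticePathMatroid D).IsConnected) {a : ℕ}
    (ha : IsUpperCorner D a) : Set.Icc 1 a ∈ (latticePathMatroid D).cyclicFlats := by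
  obtain ⟨ha1, han, hE, hN⟩ := ha
  have hS := LatticePathPair.isBetween_stepSet_Q (D := D)
  have hSc := D.Q.initialCount_stepSet_height
  have haS : a ∉ stepSet D.Q.height := fun h => by have := h.2; omega
  have haS' : a + 1 ∈ stepSet D.Q.height := succ_mem_stepSet.2 hN
  have hlt : ∀ k, 1 ≤ k → k < m + r → D.P.height k < D.Q.height k := fun k h1 h2 =>
    height_lt_of_isConnected hconn h1 h2
  rw [mem_cyclicFlats_iff]
  refine ⟨Set.Icc_subset_Icc_right han.le, fun e he hea => ?_, fun e he => ?_⟩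
  · -- A base that contains `e` and as many elements of `[a]` as possible.
    have hae : a < e := by
      by_contra h
      exact hea ⟨he.1, by omega⟩
    obtain ⟨B, hB, heB, hBa⟩ : ∃ B, D.IsBetween B ∧ e ∈ B ∧ initialCount B a = D.Q.height a := by
      by_cases heS : e ∈ stepSet D.Q.height
      · exact ⟨_, hS, heS, hSc a⟩
      · refine ⟨_, isBetween_exchange hS haS' heS he (fun k hk hke => ?_) (fun k hk hka => ?_),
          Set.mem_insert _ _, ?_⟩
        · rw [hSc]
          exact hlt k (by omega) (hke.trans_le he.2)
        · omega
        · have := initialCount_exchange haS' heS (by omega) he.1 a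
          rw [if_neg (by omega), if_neg (by omega), hSc] at this
          exact this
    have h1 := ncard_inter_le_natRk hB (insert e (Set.Icc 1 a))
    rw [Set.inter_insert_of_mem heB, Set.ncard_insert_of_notMem (fun h => hea h.2)
      ((Set.finite_Icc 1 a).inter_of_right _)] at h1
    unfold initialCount at hBa
    rw [natRk_Icc_one]
    omega
  · -- A base that avoids `e` and contains as many elements of `[a]` as possible.
    obtain ⟨B, hB, heB, hBa⟩ : ∃ B, D.IsBetween B ∧ e ∉ B ∧ initialCount B a = D.Q.height a := by
      by_cases heS : e ∈ stepSet D.Q.height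
      · have hea : e < a := he.2.lt_of_ne (by rintro rfl; exact haS heS)
        refine ⟨_, isBetween_exchange hS heS haS ⟨ha1, han.le⟩ (fun k hk hka => ?_)
          (fun k hk hke => ?_), ?_, ?_⟩
        · rw [hSc]
          exact hlt k (he.1.trans hk) (by omega)
        · omega
        · simp [hea.ne]
        · have := initialCount_exchange heS haS he.1 ha1 a
          rw [if_pos he.2, if_pos le_rfl, hSc] at this
          omega
      · exact ⟨_, hS, heS, hSc a⟩
    have h1 := ncard_inter_le_natRk hB (Set.Icc 1 a \ {e})
    have h2 := (latticePathMatroid D).natRk_mono (Set.sdiff_subset (s := Set.Icc 1 a) (t := {e}))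
    rw [← Set.inter_sdiff_assoc, Set.sdiff_singleton_eq_self (fun h => heB h.1)] at h1
    unfold initialCount at hBa
    rw [natRk_Icc_one] at h2 ⊢
    omega

theorem IsLowerCorner.mem_cyclicFlats (hconn : (latticePathMatroid D).IsConnected) {c : ℕ}
    (hc : IsLowerCorner D c) :
    Set.Icc (c + 1) (m + r) ∈ (latticePathMatroid D).cyclicFlats := by
  obtain ⟨hc1, hcn, hN, hE⟩ := hc
  have hS := LatticePathPair.isBetween_stepSet_P (D := D)
  have hSc := D.P.initialCount_stepSet_height
  have hcS : c ∈ stepSet D.P.height := ⟨hc1, hN⟩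
  have hcS' : c + 1 ∉ stepSet D.P.height := fun h => by rw [succ_mem_stepSet] at h; omega
  have hlt : ∀ k, 1 ≤ k → k < m + r → D.P.height k < D.Q.height k := fun k h1 h2 =>
    height_lt_of_isConnected hconn h1 h2
  have hrk := natRk_Icc_top D c
  rw [mem_cyclicFlats_iff]
  refine ⟨Set.Icc_subset_Icc_left (by omega), fun e he hec => ?_, fun e he => ?_⟩
  · -- A base that contains `e` and as many elements of the final interval as possible.
    have hec' : e ≤ c := by
      by_contra h
      exact hec ⟨by omega, he.2⟩
    obtain ⟨B, hB, heB, hBc⟩ : ∃ B, D.IsBetween B ∧ e ∈ B ∧ initialCount B c = D.P.height c := by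
      by_cases heS : e ∈ stepSet D.P.height
      · exact ⟨_, hS, heS, hSc c⟩
      · refine ⟨_, isBetween_exchange hS hcS heS he (fun k hk hke => ?_) (fun k hk hka => ?_),
          Set.mem_insert _ _, ?_⟩
        · omega
        · rw [hSc]
          exact hlt k (he.1.trans hk) (by omega)
        · have := initialCount_exchange hcS heS hc1 he.1 c
          rw [if_pos le_rfl, if_pos hec', hSc] at this
          omega
    have h1 := ncard_inter_le_natRk hB (insert e (Set.Icc (c + 1) (m + r)))
    rw [Set.inter_insert_of_mem heB, Set.ncard_insert_of_notMem (fun h => hec h.2)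
      ((Set.finite_Icc _ _).inter_of_right _)] at h1
    have h2 := initialCount_add_ncard_Icc (k := c) hB.subset_Icc
    rw [hB.ncard_eq] at h2
    omega
  · -- A base that avoids `e` and contains as many elements of the final interval as possible.
    obtain ⟨B, hB, heB, hBc⟩ : ∃ B, D.IsBetween B ∧ e ∉ B ∧ initialCount B c = D.P.height c := by
      by_cases heS : e ∈ stepSet D.P.height
      · have hec : c + 1 < e := he.1.lt_of_ne (by rintro rfl; exact hcS' heS)
        refine ⟨_, isBetween_exchange hS heS hcS' ⟨by omega, by omega⟩ (fun k hk hka => ?_)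
          (fun k hk hke => ?_), ?_, ?_⟩
        · omega
        · rw [hSc]
          exact hlt k (by omega) (hke.trans_le he.2)
        · simp [hec.ne']
        · have := initialCount_exchange heS hcS' (by omega) (by omega) c
          rw [if_neg (by omega), if_neg (by omega), hSc] at this
          exact this
      · exact ⟨_, hS, heS, hSc c⟩
    have h1 := ncard_inter_le_natRk hB (Set.Icc (c + 1) (m + r) \ {e})
    have h2 := (latticePathMatroid D).natRk_mono
      (Set.sdiff_subset (s := Set.Icc (c + 1) (m + r)) (t := {e}))
    rw [← Set.inter_sdiff_assoc, Set.sdiff_singleton_eq_self (fun h => heB h.1)] at h1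
    have h3 := initialCount_add_ncard_Icc (k := c) hB.subset_Icc
    rw [hB.ncard_eq] at h3
    omega

/-- If the height of `Q` after step `a` can be reached from the height of `P` after step `c` by a
lattice path, then some base has as many elements as possible in both `[a]` and `[c + 1, m + r]`,
so that these form a modular pair. -/
theorem isModularPair_of_height_le {a c : ℕ} (h : D.Q.height a ≤ D.P.height c + (a - c)) :
    (latticePathMatroid D).IsModularPair (Set.Icc 1 a) (Set.Icc (c + 1) (m + r)) := by
  let g : ℕ → ℕ := fun k =>
    max (D.P.height k) (min (D.Q.height k) (D.P.height c + (k - c)))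
  have hPQ := D.height_le
  have hg : D.IsBetween (stepSet g) := by
    refine LatticePathPair.isBetween_stepSet (fun k => ?_) (fun k => le_max_left _ _) fun k => ?_
    · have h1 := D.P.height_succ_eq_or k
      have h2 := D.Q.height_succ_eq_or k
      simp only [g]
      omega
    · have := hPQ k
      simp only [g]
      omega
  have hg0 : g 0 = 0 := by
    have h1 := D.P.height_zero
    have h2 := D.Q.height_zero
    simp only [g]
    omega
  have hgs : ∀ k, g (k + 1) = g k ∨ g (k + 1) = g k + 1 := fun k => by
    have h1 := D.P.height_succ_eq_or k
    have h2 := D.Q.height_succ_eq_or k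
    simp only [g]
    omega
  set B := stepSet g
  have hBa : initialCount B a = D.Q.height a := by
    have h1 := hPQ a
    rw [initialCount_stepSet hg0 hgs]
    simp only [g]
    omega
  have hBc : initialCount B c = D.P.height c := by
    have h1 := hPQ c
    rw [initialCount_stepSet hg0 hgs]
    simp only [g]
    omega
  have hfin : ∀ X, (B ∩ X).Finite := fun X =>
    ((Set.finite_Icc _ _).subset hg.subset_Icc).inter_of_left X
  have h1 := initialCount_add_ncard_Icc (k := c) hg.subset_Icc
  rw [hg.ncard_eq] at h1
  have h2 := Set.ncard_union_add_ncard_inter (B ∩ Set.Icc 1 a) (B ∩ Set.Icc (c + 1) (m + r))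
    (hfin _) (hfin _)
  rw [← Set.inter_union_distrib_left, ← Set.inter_inter_distrib_left] at h2
  have h3 := ncard_inter_le_natRk hg (Set.Icc 1 a ∪ Set.Icc (c + 1) (m + r))
  have h4 := ncard_inter_le_natRk hg (Set.Icc 1 a ∩ Set.Icc (c + 1) (m + r))
  have h5 := natRk_Icc_one D a
  have h6 := natRk_Icc_top D c
  have h7 := (latticePathMatroid D).eRk_inter_add_eRk_union_le (Set.Icc 1 a)
    (Set.Icc (c + 1) (m + r))
  unfold IsModularPair
  simp only [← coe_natRk] at h7 ⊢
  norm_cast at h7 ⊢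
  unfold initialCount at hBa
  omega

/-! ### Lattice paths that touch both bounding paths -/

/-- If `e` can be exchanged for `x` and not for the later element `y`, then the path of the base `B`
touches `Q` between these steps, where `Q` has just made an east step. -/
theorem exists_touch_upper {B : Set ℕ} {x y e : ℕ} (hB : D.IsBetween B) (hxy : x < y)
    (hx : x ∈ B) (hy : y ∈ B) (he : e ∉ B) (h1 : D.IsBetween (insert e (B \ {x})))
    (h2 : ¬ D.IsBetween (insert e (B \ {y}))) :
    ∃ k, x ≤ k ∧ k < y ∧ initialCount B k = D.Q.height k ∧
      D.Q.height k = D.Q.height (k - 1) := by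
  have hen : e ∈ Set.Icc 1 (m + r) := h1.subset_Icc (Set.mem_insert _ _)
  have hx1 := (hB.subset_Icc hx).1
  have hex := initialCount_exchange hx he hx1 hen.1
  obtain ⟨k, hek, hky, hk⟩ : ∃ k, e ≤ k ∧ k < y ∧ initialCount B k = D.Q.height k := by
    by_contra! hcon
    refine h2 (isBetween_exchange hB hy he hen (fun k hyk hke => ?_) fun k hek hky =>
      (hB.initialCount_le k).lt_of_ne (hcon k hek hky))
    have h3 := hex k
    have h4 := h1.le_initialCount k
    rw [if_pos (by omega), if_neg (by omega)] at h3
    omega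
  have hxk : x ≤ k := by
    by_contra hxk
    have h3 := hex k
    have h4 := h1.initialCount_le k
    rw [if_neg hxk, if_pos hek] at h3
    omega
  classical
  -- The first contact with `Q` from `max x e` on.
  have hex' : ∃ j, max x e ≤ j ∧ initialCount B j = D.Q.height j := ⟨k, by omega, hk⟩
  obtain ⟨hj, hjQ⟩ := Nat.find_spec hex'
  have hjk : Nat.find hex' ≤ k := Nat.find_min' hex' ⟨by omega, hk⟩
  have hmin := fun i => Nat.find_min hex' (m := i)
  generalize Nat.find hex' = j at hj hjQ hjk hmin
  refine ⟨j, by omega, by omega, hjQ, ?_⟩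
  obtain ⟨i, rfl⟩ : ∃ i, j = i + 1 := ⟨j - 1, by omega⟩
  refine (D.Q.height_succ_eq_or i).resolve_right fun hstep => ?_
  have h3 := hB.initialCount_le i
  have h4 := initialCount_succ_eq_or B i
  have hiB : i + 1 ≠ e := by
    rintro rfl
    have := initialCount_succ_of_notMem he
    omega
  have h5 := hmin i (by omega)
  have h6 := hex i
  have h7 := h1.initialCount_le i
  rw [if_neg (by omega), if_pos (by omega)] at h6
  omega

/-- If `f` can be exchanged for `y` and not for the earlier element `x`, then the path of the base
`B` touches `P` between these steps, where `P` is about to make an east step. -/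
theorem exists_touch_lower {B : Set ℕ} {x y f : ℕ} (hB : D.IsBetween B) (hxy : x < y)
    (hx : x ∈ B) (hy : y ∈ B) (hf : f ∉ B) (h1 : D.IsBetween (insert f (B \ {y})))
    (h2 : ¬ D.IsBetween (insert f (B \ {x}))) :
    ∃ k, x ≤ k ∧ k < y ∧ initialCount B k = D.P.height k ∧
      D.P.height (k + 1) = D.P.height k := by
  have hfn : f ∈ Set.Icc 1 (m + r) := h1.subset_Icc (Set.mem_insert _ _)
  have hy1 := (hB.subset_Icc hy).1
  have hex := initialCount_exchange hy hf hy1 hfn.1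
  obtain ⟨k, hxk, hkf, hk⟩ : ∃ k, x ≤ k ∧ k < f ∧ initialCount B k = D.P.height k := by
    by_contra! hcon
    refine h2 (isBetween_exchange hB hx hf hfn (fun k hxk hkf =>
      (hB.le_initialCount k).lt_of_ne' (hcon k hxk hkf)) fun k hfk hkx => ?_)
    have h3 := hex k
    have h4 := h1.initialCount_le k
    rw [if_neg (by omega), if_pos (by omega)] at h3
    omega
  have hky : k < y := by
    by_contra hky
    have h3 := hex k
    have h4 := h1.le_initialCount k
    rw [if_pos (by omega), if_neg (by omega)] at h3
    omega
  classical
  -- The last contact with `P` before `min y f`.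
  have hkmin : k ≤ min y f - 1 := by omega
  have hj := Nat.findGreatest_spec (P := fun j => initialCount B j = D.P.height j) hkmin hk
  have hkj := Nat.le_findGreatest (P := fun j => initialCount B j = D.P.height j) hkmin hk
  have hjle := Nat.findGreatest_le (P := fun j => initialCount B j = D.P.height j) (min y f - 1)
  have hmax := fun i => Nat.findGreatest_is_greatest (k := i)
    (P := fun j => initialCount B j = D.P.height j) (n := min y f - 1)
  generalize Nat.findGreatest (fun j => initialCount B j = D.P.height j) (min y f - 1) = j at *
  refine ⟨j, by omega, by omega, hj, ?_⟩
  refine (D.P.height_succ_eq_or j).resolve_right fun hstep => ?_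
  have h3 := hB.le_initialCount (j + 1)
  have h4 := initialCount_succ_eq_or B j
  have hjB : j + 1 ≠ f := by
    rintro rfl
    have := initialCount_succ_of_notMem hf
    omega
  have h5 := hmax (j + 1) (by omega)
  have h6 := hex (j + 1)
  have h7 := h1.le_initialCount (j + 1)
  rw [if_pos (by omega), if_neg (by omega)] at h6
  omega

/-- If `a` is the only upper corner in `[x, y)`, then a path that touches `Q` there, at the end of an
east step of `Q`, touches `Q` at `a`. -/
theorem initialCount_eq_of_touch_upper {B : Set ℕ} {x y a k : ℕ} (hB : D.IsBetween B)
    (hx : 1 ≤ x) (hy : y ∈ B) (hyn : y ≤ m + r) (hay : a < y)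
    (hcorner : ∀ c, x ≤ c → c < y → IsUpperCorner D c → c = a)
    (hxk : x ≤ k) (hky : k < y) (hkB : initialCount B k = D.Q.height k)
    (hkQ : D.Q.height k = D.Q.height (k - 1)) : initialCount B a = D.Q.height a := by
  -- Before the next corner, all steps of `Q` are east steps.
  have hflat : ∀ j, k ≤ j → j ≤ y → (∀ c, k ≤ c → c < j → c ≠ a) →
      D.Q.height j = D.Q.height k ∧ D.Q.height j = D.Q.height (j - 1) := by
    intro j hkj
    induction j, hkj using Nat.le_induction with
    | base => exact fun _ _ => ⟨rfl, hkQ⟩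
    | succ j hkj ih =>
      intro hjy hne
      obtain ⟨h1, h2⟩ := ih (by omega) fun c h3 h4 => hne c h3 (by omega)
      rcases D.Q.height_succ_eq_or j with h3 | h3
      · exact ⟨h3.trans h1, h3⟩
      · exact absurd (hcorner j (by omega) (by omega) ⟨by omega, by omega, h2, h3⟩)
          (hne j hkj (by omega))
  refine (hB.initialCount_le a).antisymm ?_
  rcases le_or_gt k a with hka | hak
  · rw [(hflat a hka hay.le fun c _ h => h.ne).1, ← hkB]
    exact initialCount_mono B hka
  · -- Otherwise `Q` stays level up to `y`, and the north step `y` of the path crosses it.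
    obtain ⟨h1, -⟩ := hflat y hky.le le_rfl fun c h _ => by omega
    obtain ⟨i, rfl⟩ : ∃ i, y = i + 1 := ⟨y - 1, by omega⟩
    have h2 := initialCount_succ_of_mem hy
    have h3 := initialCount_mono B (show k ≤ i by omega)
    have h4 := hB.initialCount_le (i + 1)
    omega

/-- If `c` is the only lower corner in `[x, y)`, then a path that touches `P` there, before an east
step of `P`, touches `P` at `c`. -/
theorem initialCount_eq_of_touch_lower {B : Set ℕ} {x y c k : ℕ} (hB : D.IsBetween B)
    (hx : x ∈ B) (hx1 : 1 ≤ x) (hyn : y ≤ m + r) (hxc : x ≤ c)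
    (hcorner : ∀ j, x ≤ j → j < y → IsLowerCorner D j → j = c)
    (hxk : x ≤ k) (hky : k < y) (hkB : initialCount B k = D.P.height k)
    (hkP : D.P.height (k + 1) = D.P.height k) : initialCount B c = D.P.height c := by
  -- After the previous corner, all steps of `P` are east steps.
  have hflat : ∀ j, j ≤ k → x ≤ j + 1 → (∀ i, j < i → i ≤ k → i ≠ c) →
      D.P.height j = D.P.height k ∧ D.P.height (j + 1) = D.P.height j := by
    intro j hjk
    induction hjk using Nat.decreasingInduction with
    | self => exact fun _ _ => ⟨rfl, hkP⟩
    | of_succ j hjk ih =>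
      intro hxj hne
      obtain ⟨h1, h2⟩ := ih (by omega) fun i h3 h4 => hne i (by omega) h4
      rcases D.P.height_succ_eq_or j with h3 | h3
      · exact ⟨h3.symm.trans h1, h3⟩
      · exact absurd (hcorner (j + 1) (by omega) (by omega) ⟨by omega, by omega, h3, h2⟩)
          (hne (j + 1) (by omega) (by omega))
  refine (hB.le_initialCount c).antisymm' ?_
  rcases le_or_gt c k with hck | hkc
  · rw [(hflat c hck (by omega) fun i h _ => h.ne').1, ← hkB]
    exact initialCount_mono B hck
  · -- Otherwise `P` is level from `x - 1` on, and the path is below it before the north step `x`.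
    obtain ⟨i, rfl⟩ : ∃ i, x = i + 1 := ⟨x - 1, by omega⟩
    obtain ⟨h1, -⟩ := hflat i (by omega) le_rfl fun j _ h => by omega
    have h2 := initialCount_succ_of_mem hx
    have h3 := initialCount_mono B hxk
    have h4 := hB.le_initialCount i
    omega

/-- The pair of an upper corner `a` and a lower corner `c` is separated if no lattice path can lead
from `P` after step `c` to `Q` after step `a`. -/
def IsSeparated (D : LatticePathPair m r) (a c : ℕ) : Prop :=
  IsUpperCorner D a ∧ IsLowerCorner D c ∧ D.P.height c + (a - c) < D.Q.height a

/-- A separated pair of corners at minimal distance encloses no other corners. -/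
theorem exists_isSeparated_forall_corner {a c : ℕ} (h : IsSeparated D a c) :
    ∃ a c, IsSeparated D a c ∧
      (∀ j, min a c ≤ j → j < max a c + 1 → IsUpperCorner D j → j = a) ∧
      (∀ j, min a c ≤ j → j < max a c + 1 → IsLowerCorner D j → j = c) := by
  induction hd : max a c - min a c using Nat.strong_induction_on generalizing a c with
  | _ d ih =>
    by_cases hU : ∀ j, min a c ≤ j → j < max a c + 1 → IsUpperCorner D j → j = a
    · by_cases hL : ∀ j, min a c ≤ j → j < max a c + 1 → IsLowerCorner D j → j = c
      · exact ⟨a, c, h, hU, hL⟩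
      · push Not at hL
        obtain ⟨j, hj1, hj2, hj, hjc⟩ := hL
        refine ih _ ?_ ⟨h.1, hj, ?_⟩ rfl
        · omega
        · have h1 := h.2.2
          rcases le_total a c with hac | hca
          · have h2 := D.P.height_mono (show j ≤ c by omega)
            omega
          · have h2 := D.P.height_le_add j c
            omega
    · push Not at hU
      obtain ⟨j, hj1, hj2, hj, hja⟩ := hU
      refine ih _ ?_ ⟨hj, h.2.1, ?_⟩ rfl
      · omega
      · have h1 := h.2.2
        rcases le_total a c with hac | hca
        · have h2 := D.Q.height_mono (show a ≤ j by omega)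
          omega
        · have h2 := D.Q.height_le_add a j
          omega

end Matroid

theorem mainTheorem2 (m r : ℕ) (D : LatticePathPair m r)
    (hconn : (Matroid.latticePathMatroid D).IsConnected)
    (a b : ℕ)
    (hA : (Matroid.latticePathMatroid D).IsInitialConnectedFlat (Set.Icc 1 a))
    (hB : (Matroid.latticePathMatroid D).IsFinalConnectedFlat (m + r) (Set.Icc b (m + r)))
    (hAB : ¬ (Matroid.latticePathMatroid D).IsModularPair (Set.Icc 1 a) (Set.Icc b (m + r))) :
    ∃ N : Matroid ℕ, N.Finite ∧
      ¬ (Matroid.latticePathMatroid D).IsIsomorphic N ∧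
      (Matroid.latticePathMatroid D).HaveSameConfiguration N := by
  open Matroid in
  obtain ⟨c, rfl, hc⟩ := hB.exists_isLowerCorner
  have hsep : IsSeparated D a c := ⟨hA.isUpperCorner, hc, by
    by_contra h
    exact hAB (isModularPair_of_height_le (by omega))⟩
  clear hA hB hAB hc
  obtain ⟨a, c, ⟨ha, hc, hlt⟩, hU, hL⟩ := exists_isSeparated_forall_corner hsep
  have ha1 := ha.1
  have ha2 := ha.2.1
  have hc1 := hc.1
  have hc2 := hc.2.1
  have hxE : min a c ∈ (latticePathMatroid D).E := ⟨by omega, by omega⟩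
  have hyE : max a c + 1 ∈ (latticePathMatroid D).E := ⟨by omega, by omega⟩
  obtain ⟨N, hN, hshift⟩ := exists_isShift (by omega) hxE hyE
    fun S e f hS hxS hyS he hf h1 h2 h3 => by
      rw [latticePathMatroid_isBase_iff] at hS h1 h2 h3 ⊢
      by_contra h4
      obtain ⟨k, hk1, hk2, hk3, hk4⟩ := exists_touch_upper hS (by omega) hxS hyS he h1 h2
      obtain ⟨l, hl1, hl2, hl3, hl4⟩ := exists_touch_lower hS (by omega) hxS hyS hf h3 h4
      have h5 := initialCount_eq_of_touch_upper hS (by omega) hyS (by omega) (by omega) hU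
        hk1 hk2 hk3 hk4
      have h6 := initialCount_eq_of_touch_lower hS hxS (by omega) (by omega) (by omega) hL
        hl1 hl2 hl3 hl4
      have h7 := initialCount_le_add S a c
      omega
  refine ⟨N, hN, hshift.not_isIsomorphic (ha.mem_cyclicFlats hconn) ⟨by omega, by omega⟩
    (fun h => ?_) (hc.mem_cyclicFlats hconn) (fun h => ?_) ⟨by omega, by omega⟩,
    hshift.haveSameConfiguration⟩
  · have := h.2
    omega
  · have := h.1
    omega
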